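/- **Setting.** Let $G$ be a second-countable locally compact (Hausdorff) topological group, $\Gamma<G$ a lattice, $Y=\Gamma\backslash G$ with its Borel $\sigma$-algebra, and $m$ the unique $G$-invariant Borel probability measure on $Y$. Let $G$ act on $Y$ from the right by inverses; for $y\in Y$, $E\subseteq G$ write $yE=\{yf^{-1}: f\in E\}$. Fix $a\in G$ and the transformation $S\colon Y\to Y$, $Sy=ya^{-1}$; "$a$-invariant" means $S$-invariant, and $h_m(a)\in[0,\infty]$ denotes the Kolmogorov–Sinai entropy (natural logarithms) of $S$ with respect to $m$. Let $K<G$ be a compact subgroup whose normalizer $N_G(K)$ is open in $G$, let $X=Y/K$ with quotient map $\pi\colon Y\to X$, and let $\mathcal X$ be the Borel $\sigma$-algebra of $X$, viewed through $\pi^{-1}$ as a sub-$\sigma$-algebra of the Borel $\sigma$-algebra of $Y$. Let $L^2(X)\subseteq L^2(Y,m)$ be the closed subspace of $\mathcal X$-measurable functions, $P_X$ the orthogonal projection onto it, $U f=f\circ S$, $T=P_XUP_X$, and let $L^2_0(X)$ be the orthogonal complement of the constants in $L^2(X)$. Assume: 1. $\lambda:=\|T\|_{L^2_0(X)}<1$.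 2. (Property (M)) There is a closed $U$-stable subspace $\mathcal M\subseteq L^2(Y,m)$ that is stable under multiplication by $L^\infty(X)$, contains $L^2(X)$, and satisfies $P_XUP_Xf=P_XUf$ for all $f\in\mathcal M$. 3. (The Haar measure is $a$-homogeneous) For $B\subseteq G$ and integers $s\le t$ put $B^{(s,t)}=\bigcap_{s\le i\le t}a^{-i}Ba^{i}$. For every real $h'>h_m(a)$ the identity of $G$ has a base of neighborhoods $B$ that are $(a,h')$-homogeneous: there is $C_{B,h'}>0$ such that $m_G(B^{(s,t)})\ge C_{B,h'}e^{-h'(t-s+1)}$ for all integers $s\le 0\le t$, where $m_G$ is a Haar measure on $G$. Write $\nu(\varphi)=\int_Y\varphi\,d\nu$, let $\lambda^{\mathbb N}=\{\lambda^k : k\ge 1\}$, and let $D(p\,\|\,q)=-p\log\frac{q}{p}-(1-p)\log\frac{1-q}{1-p}$ be the binary Kullback–Leibler divergence. **Proposition.** Let $(\mu_i)_i$ be a sequence of $a$-invariant Borel probability measures on $Y$ that converges in the weak-$*$ topology (tested on $C_c(Y)$) to a probability measure $\mu$, and let $h>0$. Let $\mathcal F$ be a family of compact subsets of $Y$ such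 that for every $\varepsilon>0$ there is $\Omega\in\mathcal F$ with $\limsup_{i\to\infty}\mu_i(\Omega)\ge 1-\varepsilon$. Assume that for every $\Omega\in\mathcal F$ there are an identity neighborhood $B\subseteq G$, a sequence of positive integers $t_i\to\infty$, and a constant $C_\Omega>0$ such that for all $i$ $$\int_\Omega \mu_i\bigl(yB^{(-t_i,t_i)}\bigr)\,d\mu_i(y)\le C_\Omega e^{-2ht_i}.$$ Let $\varphi\colon Y\to[0,1]$ be $\mathcal X$-measurable, and either continuous or the characteristic function of (the preimage in $Y$ of) a closed or an open subset of $X$. Then: (a) If $1>\mu(\varphi)>m(\varphi)$, then for every $\theta\in\lambda^{\mathbb N}$ with $\theta<\frac{\mu(\varphi)-m(\varphi)}{1-m(\varphi)}$, $$\frac{D\bigl(\mu(\varphi)\,\|\,\theta+(1-\theta)m(\varphi)\bigr)}{-\log\theta}\le\frac{h_m(a)-h}{-\log\lambda}.$$ (b) If $0<\mu(\varphi)<m(\varphi)$, then for every $\theta\in\lambda^{\mathbb N}$ with $\theta<\frac{m(\varphi)-\mu(\varphi)}{m(\varphi)}$, $$\frac{D\bigl(\mu(\varphi)\,\|\,(1-\theta)m(\varphi)\bigr)}{-\log\theta}\le\frac{h_m(a)-h}{-\log\lambda}.$$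 (If $h_m(a)=\infty$ the right-hand sides are $+\infty$. If $\lambda=0$, so that $-\log\theta=-\log\lambda=+\infty$, both sides are read as $0$ and nothing is claimed.) -/

import Mathlib

open MeasureTheory Filter Topology
open scoped ENNReal Pointwise

noncomputable section

/-! ### Averaging operators of a measure preserving system relative to a state space

A state space of `(Y, mY, m, S)` is recorded by its σ-algebra `mX ≤ mY`; the space `L²(X)` is the
closed subspace `lpMeas ℂ ℂ mX 2 m` of `L²(Y, m)`. -/

/-- The Koopman operator `U_S f = f ∘ S` on `L²(Y, m)`. -/
def koopman {Y : Type*} [MeasurableSpace Y] {m : Measure Y} {S : Y → Y}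
    (hS : MeasurePreserving S m m) : Lp ℂ 2 m →L[ℂ] Lp ℂ 2 m :=
  (Lp.compMeasurePreservingₗᵢ ℂ S hS).toContinuousLinearMap

/-- The orthogonal projection `P_X = 𝔼(· ∣ mX)` of `L²(Y, m)` onto `L²(X)`. -/
def stateProj {Y : Type*} {mX mY : MeasurableSpace Y} (hX : mX ≤ mY) (m : Measure Y) :
    Lp ℂ 2 m →L[ℂ] Lp ℂ 2 m :=
  (lpMeas ℂ ℂ mX 2 m).subtypeL ∘L (condExpL2 (μ := m) ℂ ℂ hX)

/-- The averaging operator `T = P_X U_S P_X`. -/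
def averagingOperator {Y : Type*} {mX mY : MeasurableSpace Y} (hX : mX ≤ mY) {m : Measure Y}
    {S : Y → Y} (hS : MeasurePreserving S m m) : Lp ℂ 2 m →L[ℂ] Lp ℂ 2 m :=
  stateProj hX m ∘L koopman hS ∘L stateProj hX m

/-- `L²₀(X)`: the elements of `L²(X)` orthogonal to the constant functions. -/
def stateL20 {Y : Type*} (mX : MeasurableSpace Y) {mY : MeasurableSpace Y}
    (m : Measure Y) [IsFiniteMeasure m] : Submodule ℂ (Lp ℂ 2 m) :=
  lpMeas ℂ ℂ mX 2 m ⊓ (Submodule.span ℂ {Lp.const 2 m (1 : ℂ)})ᗮ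

/-- The operator norm `‖T‖` of the averaging operator on `L²₀(X)`. -/
def averagingNorm {Y : Type*} {mX mY : MeasurableSpace Y} (hX : mX ≤ mY) {m : Measure Y}
    [IsFiniteMeasure m] {S : Y → Y} (hS : MeasurePreserving S m m) : ℝ :=
  ‖averagingOperator hX hS ∘L (stateL20 mX m).subtypeL‖

/-- Property (M): there is a closed `U_S`-stable `L^∞(X)`-submodule `M` of `L²(Y)` that contains
`L²(X)` and on which `P_X U_S P_X = P_X U_S`. -/
def PropertyM {Y : Type*} {mX mY : MeasurableSpace Y} (hX : mX ≤ mY) {m : Measure Y}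
    {S : Y → Y} (hS : MeasurePreserving S m m) : Prop :=
  ∃ M : Submodule ℂ (Lp ℂ 2 m),
    IsClosed (M : Set (Lp ℂ 2 m)) ∧
    (∀ f ∈ M, koopman hS f ∈ M) ∧
    (∀ g : Lp ℂ ∞ m, AEStronglyMeasurable[mX] g m → ∀ f ∈ M, (g • f : Lp ℂ 2 m) ∈ M) ∧
    lpMeas ℂ ℂ mX 2 m ≤ M ∧
    ∀ f ∈ M, stateProj hX m (koopman hS (stateProj hX m f)) = stateProj hX m (koopman hS f)

/-! ### Measure theoretic entropy (Kolmogorov–Sinai) -/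

/-- Shannon entropy, in natural base, of the finite partition of `Y` into the fibres of `ξ`. -/
def partitionEntropy {Y ι : Type*} [MeasurableSpace Y] [Fintype ι] (μ : Measure Y)
    (ξ : Y → ι) : ℝ :=
  ∑ c, Real.negMulLog (μ.real (ξ ⁻¹' {c}))

/-- `h_μ(S, ξ) = lim (1/n) H_μ(ξ ∨ S⁻¹ξ ∨ ⋯ ∨ S^{-(n-1)}ξ)`. For `S`-invariant probability measures
the limit exists, so the upper limit is the limit. -/
def partitionEntropyRate {Y ι : Type*} [MeasurableSpace Y] [Fintype ι] (μ : Measure Y)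
    (S : Y → Y) (ξ : Y → ι) : ℝ≥0∞ :=
  limsup (fun n : ℕ =>
    ENNReal.ofReal (partitionEntropy μ (fun y (i : Fin n) => ξ (S^[(i : ℕ)] y)) / n)) atTop

/-- The entropy `h_μ(S) ∈ [0, ∞]`: the supremum of `h_μ(S, ξ)` over finite measurable
partitions `ξ`. -/
def measureEntropy {Y : Type*} [MeasurableSpace Y] (μ : Measure Y) (S : Y → Y) : ℝ≥0∞ :=
  ⨆ (k : ℕ) (ξ : Y → Fin k) (_ : Measurable ξ), partitionEntropyRate μ S ξ

/-- The binary Kullback–Leibler divergence `D(a ‖ b)` in natural base. -/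
def binaryKL (a b : ℝ) : ℝ :=
  -a * Real.log (b / a) - (1 - a) * Real.log ((1 - b) / (1 - a))

/-! ### The homogeneous space `Y = Γ\G` and its state space `X = Y/K` -/

/-- `Y = Γ\G`, the space of cosets `Γx`. -/
def RightCosetSpace {G : Type*} [Group G] (Γ : Subgroup G) : Type _ :=
  Quotient (QuotientGroup.rightRel Γ)

namespace RightCosetSpace

variable {G : Type*} [Group G] {Γ : Subgroup G}

/-- The projection `x ↦ Γx`. -/
def mk (Γ : Subgroup G) (x : G) : RightCosetSpace Γ :=
  Quotient.mk (QuotientGroup.rightRel Γ) x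

/-- `G` acts on `Γ\G` through the right action by inverses: `g • Γx = Γxg⁻¹`. -/
instance : MulAction G (RightCosetSpace Γ) where
  smul g := Quotient.map' (s₁ := QuotientGroup.rightRel Γ) (s₂ := QuotientGroup.rightRel Γ)
    (fun x => x * g⁻¹) (by
      intro x y h
      rw [QuotientGroup.rightRel_apply] at h ⊢
      simpa [mul_assoc] using h)
  one_smul y := by
    induction y using Quotient.inductionOn'
    exact congrArg (mk Γ) (by simp)
  mul_smul g h y := by
    induction y using Quotient.inductionOn'
    exact congrArg (mk Γ) (by simp [mul_assoc])

theorem smul_mk (g x : G) : g • mk Γ x = mk Γ (x * g⁻¹) := rfl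

variable [TopologicalSpace G]

/-- The quotient topology on `Γ\G`. -/
instance : TopologicalSpace (RightCosetSpace Γ) :=
  inferInstanceAs (TopologicalSpace (Quotient (QuotientGroup.rightRel Γ)))

/-- The Borel σ-algebra on `Γ\G`. -/
instance : MeasurableSpace (RightCosetSpace Γ) := borel _

instance : BorelSpace (RightCosetSpace Γ) := ⟨rfl⟩

instance [IsTopologicalGroup G] : ContinuousConstSMul G (RightCosetSpace Γ) where
  continuous_const_smul g := by
    refine continuous_quot_lift _ ?_
    exact continuous_quot_mk.comp (continuous_mul_const g⁻¹)

end RightCosetSpace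

/-- The state space `X = Y/K = Γ\G/K` with the quotient topology. -/
abbrev StateSpace {G : Type*} [Group G] (Γ K : Subgroup G) : Type _ :=
  MulAction.orbitRel.Quotient K (RightCosetSpace Γ)

/-- The quotient map `π : Y → X`. -/
def stateMap {G : Type*} [Group G] (Γ K : Subgroup G) : RightCosetSpace Γ → StateSpace Γ K :=
  Quotient.mk (MulAction.orbitRel K (RightCosetSpace Γ))

/-- The Borel σ-algebra of `X`, viewed as a sub-σ-algebra of that of `Y` through `π`. -/
@[reducible] def stateAlgebra {G : Type*} [Group G] [TopologicalSpace G] (Γ K : Subgroup G) :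
    MeasurableSpace (RightCosetSpace Γ) :=
  MeasurableSpace.comap (stateMap Γ K) (borel (StateSpace Γ K))

theorem stateAlgebra_le {G : Type*} [Group G] [TopologicalSpace G] (Γ K : Subgroup G) :
    stateAlgebra Γ K ≤ (inferInstance : MeasurableSpace (RightCosetSpace Γ)) := by
  have h : Continuous (stateMap Γ K) := continuous_quot_mk
  let _ : MeasurableSpace (StateSpace Γ K) := borel _
  have : BorelSpace (StateSpace Γ K) := ⟨rfl⟩
  exact h.measurable.comap_le

/-- `B^{(s,t)} = ⋂_{s ≤ i ≤ t} a⁻ⁱ B aⁱ`. -/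
def bowen {G : Type*} [Group G] (a : G) (B : Set G) (s t : ℤ) : Set G :=
  {g | ∀ i : ℤ, s ≤ i → i ≤ t → ∃ b ∈ B, g = a ^ (-i) * b * a ^ i}

/-- The Bowen ball `y B^{(s,t)} = {y f⁻¹ | f ∈ B^{(s,t)}}` around `y ∈ Γ\G`. -/
def bowenBall {G : Type*} [Group G] {Γ : Subgroup G} (a : G) (B : Set G) (s t : ℤ)
    (y : RightCosetSpace Γ) : Set (RightCosetSpace Γ) :=
  (fun f : G => f • y) '' bowen a B s t

/-- `B` is `(a,h)`-homogeneous: `m_G(B^{(s,t)}) ≥ C exp(-h (t - s + 1))` for all `s ≤ 0 ≤ t`, with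
some `C > 0`. The normalization of the Haar measure of `G` only affects `C`. -/
def IsHomogeneousNhd {G : Type*} [Group G] [TopologicalSpace G] [IsTopologicalGroup G]
    [LocallyCompactSpace G] [MeasurableSpace G] [BorelSpace G] (a : G) (h : ℝ)
    (B : Set G) : Prop :=
  ∃ C : ℝ, 0 < C ∧ ∀ s t : ℤ, s ≤ 0 → 0 ≤ t →
    ENNReal.ofReal (C * Real.exp (-h * ((t : ℝ) - s + 1))) ≤
      (Measure.haar : Measure G) (bowen a B s t)

/-- The Haar measure is `a`-homogeneous: for every real `h > h_m(a)` the `(a,h)`-homogeneous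
neighborhoods form a base at the identity of `G`. -/
def IsHaarHomogeneous {G : Type*} [Group G] [TopologicalSpace G] [IsTopologicalGroup G]
    [LocallyCompactSpace G] [MeasurableSpace G] [BorelSpace G] {Γ : Subgroup G}
    (m : Measure (RightCosetSpace Γ)) (a : G) : Prop :=
  ∀ h : ℝ, 0 ≤ h → measureEntropy m (fun y => a • y) < ENNReal.ofReal h →
    ∀ U ∈ 𝓝 (1 : G), ∃ B ∈ 𝓝 (1 : G), B ⊆ U ∧ IsHomogeneousNhd a h B

end

/-! The proof estimates the `m`-measure of one set in two ways. Put `θ = λ^k`, take `φ` continuous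
with compact support, and let `E'` be the set of points where the average of `φ` over times spaced
by `k` in the window `[-t, t]` is at least `p`, for some `p` below `μ(φ)`.

Upper bound. Exponential tilting dominates `e^{βφ}` by the affine weight `1 + (e^β - 1)φ`. Let `R`
be multiplication by its square root. Property (M) turns the integral of the product of weights
along an orbit into a matrix coefficient of a product of operators `R T^k R` on `L²(X)`. By
`norm_compression_le` each factor costs no more than one independent trial with success probability
`δ = θ + (1-θ) m(φ)`. Markov's inequality then yields `m(E') ≤ exp(-n D(p‖δ))` with `n ≈ 2t/k`
(`measureReal_le_exp_neg_binaryKL`).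

Lower bound. By invariance, `μᵢ` gives definite mass to points of `Ω` with a large average
(`lt_measureReal_le_sum`). Since Bowen balls have small average mass, of order `e^{2ht}` disjoint
ones can be centred at such points (`le_measureReal_of_lintegral_le`). Each has `m`-volume of order
at least `e^{-2h't}` for any `h' > h_m(a)` (`exists_le_measure_bowenBall`), and uniform continuity
puts all of them inside `E'`.

Comparing exponents gives `D ≤ k(h' - h)`; then `h'` decreases to `h_m(a)`, and `-log θ = -k log λ`
absorbs `k`. A general `φ` is a pointwise limit of such functions on `X`: the limit in `i` is taken
for each approximant, and continuity of `D` does the rest. Statement (b) is (a) for `1 - φ`. -/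

namespace RightCosetSpace

/-! ### Topology of `Γ\G` -/

variable {G : Type*} [Group G] {Γ : Subgroup G} [TopologicalSpace G] [IsTopologicalGroup G]

theorem isOpenQuotientMap_mk (Γ : Subgroup G) : IsOpenQuotientMap (mk Γ) :=
  MulAction.isOpenQuotientMap_quotientMk (Γ := Γ) (T := G)

theorem continuousSMul : ContinuousSMul G (RightCosetSpace Γ) where
  continuous_smul := by
    rw [← (IsOpenQuotientMap.id.prodMap (isOpenQuotientMap_mk Γ)).continuous_comp_iff]
    exact (isOpenQuotientMap_mk Γ).continuous.comp
      (f := fun p : G × G => p.2 * p.1⁻¹) (by fun_prop)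

instance [SecondCountableTopology G] : SecondCountableTopology (RightCosetSpace Γ) :=
  ContinuousConstSMul.secondCountableTopology (Γ := Γ) (T := G)

instance [LocallyCompactSpace G] : LocallyCompactSpace (RightCosetSpace Γ) :=
  (isOpenQuotientMap_mk Γ).locallyCompactSpace

instance [T2Space G] [DiscreteTopology Γ] : T2Space (RightCosetSpace Γ) :=
  have : IsClosed (Γ : Set G) := Subgroup.isClosed_of_discrete
  t2Space_quotient_mulAction_of_properSMul (G := Γ) (X := G)

/-- Orbit maps of the transitive action of `G` on `Γ\G` are open. -/
theorem isOpenMap_smul (y : RightCosetSpace Γ) : IsOpenMap (fun g : G => g • y) := by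
  obtain ⟨x, rfl⟩ := (isOpenQuotientMap_mk Γ).surjective y
  have h : IsOpenMap (fun g : G => mk Γ (x * g⁻¹)) :=
    (isOpenQuotientMap_mk Γ).isOpenMap.comp
      ((Homeomorph.inv G).trans (Homeomorph.mulLeft x)).isOpenMap
  exact h

theorem exists_smul_eq (y z : RightCosetSpace Γ) : ∃ g : G, g • y = z := by
  obtain ⟨x, rfl⟩ := (isOpenQuotientMap_mk Γ).surjective y
  obtain ⟨x', rfl⟩ := (isOpenQuotientMap_mk Γ).surjective z
  exact ⟨x'⁻¹ * x, by rw [smul_mk]; simp⟩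

theorem image_smul_mem_nhds {V : Set G} (hV : V ∈ 𝓝 1) (y : RightCosetSpace Γ) :
    (fun g : G => g • y) '' V ∈ 𝓝 y := by
  simpa using (isOpenMap_smul y).image_mem_nhds hV

/-- A neighborhood of the identity of `G` moves the points of a compact set injectively. -/
theorem exists_nhds_injOn_smul [DiscreteTopology Γ] {Ω : Set (RightCosetSpace Γ)}
    (hΩ : IsCompact Ω) : ∃ U ∈ 𝓝 (1 : G), ∀ y ∈ Ω, Set.InjOn (fun g : G => g • y) U := by
  refine hΩ.induction_on (p := fun Ω => ∃ U ∈ 𝓝 (1 : G), ∀ y ∈ Ω,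
    Set.InjOn (fun g : G => g • y) U) ?_ ?_ ?_ ?_
  · exact ⟨Set.univ, univ_mem, by simp⟩
  · intro s t hst ht
    obtain ⟨U, hU, h⟩ := ht
    exact ⟨U, hU, fun y hy => h y (hst hy)⟩
  · intro s t hs ht
    obtain ⟨U, hU, h⟩ := hs
    obtain ⟨U', hU', h'⟩ := ht
    refine ⟨U ∩ U', inter_mem hU hU', ?_⟩
    rintro y (hy | hy)
    · exact (h y hy).mono Set.inter_subset_left
    · exact (h' y hy).mono Set.inter_subset_right
  · intro y hy
    obtain ⟨x, rfl⟩ := (isOpenQuotientMap_mk Γ).surjective y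
    obtain ⟨N, hN, hNΓ⟩ : ∃ N ∈ 𝓝 (1 : G), ∀ g ∈ N, g ∈ Γ → g = 1 := by
      have h1 : ({1} : Set Γ) ∈ 𝓝 (1 : Γ) := by simp
      rw [nhds_subtype_eq_comap, mem_comap] at h1
      obtain ⟨N, hN, hN'⟩ := h1
      refine ⟨N, hN, fun g hg hgΓ => ?_⟩
      simpa using hN' (show (⟨g, hgΓ⟩ : Γ) ∈ Subtype.val ⁻¹' N from hg)
    -- If `g` and `g'` agree at `Γxw⁻¹`, this conjugate of `g'⁻¹g` lies in `Γ`. Near the identity it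
    -- can only be `1`, uniformly in `w`.
    have hc : Tendsto (fun p : (G × G) × G => x * p.2⁻¹ * (p.1.1⁻¹ * p.1.2) * p.2 * x⁻¹)
        (𝓝 ((1, 1), 1)) (𝓝 1) := by
      refine Continuous.tendsto' (by fun_prop) _ _ (by simp)
    have hc' := hc hN
    rw [mem_map, nhds_prod_eq, nhds_prod_eq, mem_prod_iff] at hc'
    obtain ⟨A, hA, W, hW, hAW⟩ := hc'
    obtain ⟨U, hU, hUA⟩ := mem_prod_self_iff.1 hA
    refine ⟨_, mem_nhdsWithin_of_mem_nhds (image_smul_mem_nhds hW _), U, hU, ?_⟩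
    rintro _ ⟨w, hw, rfl⟩ g hg g' hg' heq
    simp only [smul_mk] at heq
    have hΓ := Quotient.exact heq
    change (QuotientGroup.rightRel Γ) _ _ at hΓ
    rw [QuotientGroup.rightRel_apply] at hΓ
    have h1 : x * w⁻¹ * (g'⁻¹ * g) * w * x⁻¹ = 1 :=
      hNΓ _ (hAW (show ((g', g), w) ∈ A ×ˢ W from ⟨hUA ⟨hg', hg⟩, hw⟩)) (by
        simpa [mul_assoc] using hΓ)
    have h2 : g'⁻¹ * g = 1 := by
      have : g'⁻¹ * g = (x * w⁻¹)⁻¹ * (x * w⁻¹ * (g'⁻¹ * g) * w * x⁻¹) * (x * w⁻¹) := by group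
      rw [this, h1]; group
    exact (inv_mul_eq_one.1 h2).symm

end RightCosetSpace

/-! ### Continuous actions: uniform continuity and properness -/

section action
variable {G Y : Type*} [Group G] [TopologicalSpace G] [TopologicalSpace Y]
  [MulAction G Y] [ContinuousSMul G Y]

/-- Compactly supported continuous functions are uniformly continuous along a continuous action. -/
theorem exists_nhds_abs_smul_sub_lt [IsTopologicalGroup G] {ψ : Y → ℝ} (hψ : Continuous ψ) (hc : HasCompactSupport ψ)
    {ε : ℝ} (hε : 0 < ε) : ∃ V ∈ 𝓝 (1 : G), ∀ v ∈ V, ∀ y, |ψ (v • y) - ψ y| < ε := by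
  have h1 : ∀ᶠ v in 𝓝 (1 : G), ∀ y ∈ tsupport ψ, |ψ (v • y) - ψ y| < ε := by
    refine hc.isCompact.eventually_forall_of_forall_eventually fun y _ => ?_
    have : Continuous fun p : G × Y => |ψ (p.1 • p.2) - ψ p.2| := by fun_prop
    exact (this.tendsto (1, y)).eventually (gt_mem_nhds (by simpa using hε))
  have h2 : ∀ᶠ v in 𝓝 (1 : G), ∀ y ∈ tsupport ψ, |ψ (v⁻¹ • y) - ψ y| < ε :=
    (continuous_inv.tendsto' (1 : G) 1 inv_one).eventually h1
  refine ⟨_, h1.and h2, ?_⟩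
  rintro v ⟨hv1, hv2⟩ y
  by_cases hy : y ∈ tsupport ψ
  · exact hv1 y hy
  by_cases hvy : v • y ∈ tsupport ψ
  · have := hv2 _ hvy
    rwa [inv_smul_smul, abs_sub_comm] at this
  · rw [image_eq_zero_of_notMem_tsupport hy, image_eq_zero_of_notMem_tsupport hvy]
    simpa using hε

/-- The shear `(g, y) ↦ (g, g • y)` carries the proper projection to `Y` into the action map. A pair
whose first coordinate is proper is proper. This makes the state space Hausdorff. -/
theorem properSMul_of_compactSpace [IsTopologicalGroup G] [CompactSpace G] [T2Space Y] : ProperSMul G Y where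
  isProperMap_smul_pair := by
    have hh : IsProperMap (Prod.snd : G × Y → Y) := isProperMap_snd_of_compactSpace
    let e : G × Y ≃ₜ G × Y :=
      { toFun := fun p => (p.1, p.1 • p.2)
        invFun := fun p => (p.1, p.1⁻¹ • p.2)
        left_inv := fun p => by simp
        right_inv := fun p => by simp
        continuous_toFun := by fun_prop
        continuous_invFun := by fun_prop }
    have h2 : IsProperMap (Prod.fst ∘ fun p : G × Y => (p.1 • p.2, p.2)) :=
      hh.comp e.isProperMap
    exact isProperMap_of_comp_of_t2 (by fun_prop) (by fun_prop) h2

/-- The quotient map by a compact group is proper. -/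
theorem isCompact_preimage_quotientMk [CompactSpace G] [LocallyCompactSpace Y]
    {C : Set (MulAction.orbitRel.Quotient G Y)} (hC : IsCompact C) (hC' : IsClosed C) :
    IsCompact ((Quotient.mk (MulAction.orbitRel G Y) : Y → MulAction.orbitRel.Quotient G Y) ⁻¹' C) := by
  have hq := MulAction.isOpenQuotientMap_quotientMk (Γ := G) (T := Y)
  suffices h : ∃ D : Set Y, IsCompact D ∧ (Quotient.mk (MulAction.orbitRel G Y) : Y → _) ⁻¹' C ⊆ D by
    obtain ⟨D, hD, hCD⟩ := h
    exact hD.of_isClosed_subset (hC'.preimage hq.continuous) hCD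
  clear hC'
  refine hC.induction_on (p := fun C => ∃ D : Set Y, IsCompact D ∧
    (Quotient.mk (MulAction.orbitRel G Y) : Y → _) ⁻¹' C ⊆ D) ?_ ?_ ?_ ?_
  · exact ⟨∅, isCompact_empty, by simp⟩
  · intro s t hst ht
    obtain ⟨D, hD, h⟩ := ht
    exact ⟨D, hD, (Set.preimage_mono hst).trans h⟩
  · intro s t hs ht
    obtain ⟨D, hD, h⟩ := hs
    obtain ⟨D', hD', h'⟩ := ht
    exact ⟨D ∪ D', hD.union hD', Set.union_subset_union h h'⟩
  · intro x hx
    obtain ⟨y, rfl⟩ := hq.surjective x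
    obtain ⟨N, hN, hyN⟩ := exists_compact_mem_nhds y
    refine ⟨_, mem_nhdsWithin_of_mem_nhds (hq.isOpenMap.image_mem_nhds hyN),
      (Set.univ : Set G) • N, isCompact_univ.smul_set hN, ?_⟩
    rintro z ⟨w, hw, hwz⟩
    obtain ⟨g, hg⟩ := MulAction.orbitRel_apply.1 (Quotient.exact hwz.symm)
    exact ⟨g, trivial, w, hw, hg⟩

end action

/-! ### Approximation of test functions on the state space -/

/-- Continuous functions and indicators of closed or open sets are pointwise limits of compactly
supported continuous functions. -/
theorem exists_tendsto_of_continuous_or_indicator {X : Type*} [TopologicalSpace X] [T2Space X]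
    [LocallyCompactSpace X] [SecondCountableTopology X] {f : X → ℝ}
    (hf01 : ∀ x, f x ∈ Set.Icc (0 : ℝ) 1)
    (hf : Continuous f ∨ ∃ A : Set X, (IsClosed A ∨ IsOpen A) ∧
      f = A.indicator (fun _ => (1 : ℝ))) :
    ∃ F : ℕ → X → ℝ, (∀ n, Continuous (F n)) ∧ (∀ n, HasCompactSupport (F n)) ∧
      (∀ n x, F n x ∈ Set.Icc (0 : ℝ) 1) ∧ ∀ x, Tendsto (F · x) atTop (𝓝 (f x)) := by
  obtain ⟨F, hF, hF01, hFf⟩ : ∃ F : ℕ → X → ℝ, (∀ n, Continuous (F n)) ∧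
      (∀ n x, F n x ∈ Set.Icc (0 : ℝ) 1) ∧ ∀ x, Tendsto (F · x) atTop (𝓝 (f x)) := by
    have hclosed : ∀ A : Set X, IsClosed A → ∃ F : ℕ → X → ℝ, (∀ n, Continuous (F n)) ∧
        (∀ n x, F n x ∈ Set.Icc (0 : ℝ) 1) ∧
        ∀ x, Tendsto (F · x) atTop (𝓝 (A.indicator (fun _ => (1 : ℝ)) x)) := by
      intro A hA
      refine ⟨fun n x => hA.apprSeq n x, fun n => ?_, fun n x => ⟨NNReal.coe_nonneg _, ?_⟩,
        fun x => ?_⟩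
      · exact NNReal.continuous_coe.comp (hA.apprSeq n).continuous
      · exact_mod_cast HasOuterApproxClosed.apprSeq_apply_le_one hA n x
      · have h := tendsto_pi_nhds.1 (HasOuterApproxClosed.tendsto_apprSeq hA) x
        convert NNReal.tendsto_coe.2 h
        by_cases hx : x ∈ A <;> simp [hx]
    rcases hf with hf | ⟨A, hA | hA, rfl⟩
    · exact ⟨fun _ => f, fun _ => hf, fun _ => hf01, fun _ => tendsto_const_nhds⟩
    · exact hclosed A hA
    · obtain ⟨F, hF, hF01, hFf⟩ := hclosed Aᶜ hA.isClosed_compl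
      refine ⟨fun n x => 1 - F n x, fun n => continuous_const.sub (hF n),
        fun n x => ⟨by linarith [(hF01 n x).2], by linarith [(hF01 n x).1]⟩, fun x => ?_⟩
      convert tendsto_const_nhds.sub (hFf x) using 2
      by_cases hx : x ∈ A <;> simp [hx]
  have hχ : ∀ n, ∃ χ : C(X, ℝ), Set.EqOn χ 1 (CompactExhaustion.choice X n) ∧
      Set.EqOn χ 0 ∅ ∧ HasCompactSupport χ ∧ ∀ x, χ x ∈ Set.Icc (0 : ℝ) 1 := fun n =>
    exists_continuous_one_zero_of_isCompact ((CompactExhaustion.choice X).isCompact n)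
      isClosed_empty (Set.disjoint_empty _)
  choose χ h1 _ hc h01 using hχ
  refine ⟨fun n x => F n x * χ n x, fun n => (hF n).mul (χ n).continuous,
    fun n => (hc n).mul_left, fun n x => ⟨mul_nonneg (hF01 n x).1 (h01 n x).1,
      mul_le_one₀ (hF01 n x).2 (h01 n x).1 (h01 n x).2⟩, fun x => ?_⟩
  -- The cutoffs equal `1` on the exhausting compact sets, so at a fixed point they eventually
  -- change nothing.
  refine (hFf x).congr' ?_
  filter_upwards [eventually_ge_atTop ((CompactExhaustion.choice X).find x)] with n hn
  rw [h1 n ((CompactExhaustion.mem_iff_find_le _).2 hn)]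
  simp

section stateSpace
attribute [local instance] RightCosetSpace.continuousSMul

variable {G : Type*} [Group G] [TopologicalSpace G] [IsTopologicalGroup G] [T2Space G]
  [LocallyCompactSpace G] [SecondCountableTopology G] {Γ K : Subgroup G}

/-- Functions on the state space are pointwise limits of compactly supported continuous ones. -/
theorem exists_tendsto_stateAlgebra [DiscreteTopology Γ] (hK : IsCompact (K : Set G))
    {φ : RightCosetSpace Γ → ℝ} (hφ01 : ∀ y, φ y ∈ Set.Icc (0 : ℝ) 1)
    (hφX : Measurable[stateAlgebra Γ K] φ)
    (hφ : Continuous φ ∨ ∃ A : Set (StateSpace Γ K), (IsClosed A ∨ IsOpen A) ∧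
      φ = (stateMap Γ K ⁻¹' A).indicator (fun _ => (1 : ℝ))) :
    ∃ ψ : ℕ → RightCosetSpace Γ → ℝ, (∀ n, Continuous (ψ n)) ∧ (∀ n, HasCompactSupport (ψ n)) ∧
      (∀ n y, ψ n y ∈ Set.Icc (0 : ℝ) 1) ∧ (∀ n, Measurable[stateAlgebra Γ K] (ψ n)) ∧
      ∀ y, Tendsto (ψ · y) atTop (𝓝 (φ y)) := by
  have : CompactSpace K := isCompact_iff_compactSpace.1 hK
  have : ProperSMul K (RightCosetSpace Γ) := properSMul_of_compactSpace
  have hq : IsOpenQuotientMap (stateMap Γ K) := MulAction.isOpenQuotientMap_quotientMk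
  have : T2Space (StateSpace Γ K) := t2Space_quotient_mulAction_of_properSMul
  have : SecondCountableTopology (StateSpace Γ K) :=
    ContinuousConstSMul.secondCountableTopology (Γ := K) (T := RightCosetSpace Γ)
  have : LocallyCompactSpace (StateSpace Γ K) := hq.locallyCompactSpace
  let _ : MeasurableSpace (StateSpace Γ K) := borel _
  have : BorelSpace (StateSpace Γ K) := ⟨rfl⟩
  obtain ⟨f, rfl⟩ : ∃ f : StateSpace Γ K → ℝ, φ = f ∘ stateMap Γ K := by
    have h : φ.FactorsThrough (stateMap Γ K) := Measurable.factorsThrough hφX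
    exact ⟨_, (h.extend_comp (fun _ => (0 : ℝ))).symm⟩
  have hf01 : ∀ x, f x ∈ Set.Icc (0 : ℝ) 1 := fun x => by
    obtain ⟨y, rfl⟩ := hq.surjective x
    exact hφ01 y
  obtain ⟨F, hF, hFc, hF01, hFf⟩ := exists_tendsto_of_continuous_or_indicator hf01 (by
    refine hφ.imp hq.continuous_comp_iff.1 ?_
    rintro ⟨A, hA, h⟩
    refine ⟨A, hA, funext fun x => ?_⟩
    obtain ⟨y, rfl⟩ := hq.surjective x
    exact congrFun h y)
  refine ⟨fun n => F n ∘ stateMap Γ K, fun n => (hF n).comp hq.continuous, fun n => ?_,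
    fun n y => hF01 n _, fun n => ?_, fun y => hFf _⟩
  · exact HasCompactSupport.of_support_subset_isCompact
      (isCompact_preimage_quotientMk (G := K) (hFc n).isCompact (isClosed_tsupport _))
      fun y hy => subset_tsupport _ hy
  · exact (hF n).measurable.comp (comap_measurable _)

end stateSpace

/-! ### Compression of an operator with a norm gap -/

section hilbert
variable {H : Type*} [NormedAddCommGroup H] [InnerProductSpace ℂ H]

/-- An operator `Q` with a norm gap on the orthogonal complement of an invariant unit vector `e`,
compressed by a symmetric operator `R`. -/
theorem norm_compression_le {e : H} (he : ‖e‖ = 1) {V : Submodule ℂ H} (heV : e ∈ V)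
    {Q R : H →ₗ[ℂ] H} (hQe : Q e = e) {θ b c : ℝ} (hθ0 : 0 ≤ θ) (hθ1 : θ ≤ 1)
    (hQo : ∀ u ∈ V, inner ℂ e u = 0 → inner ℂ e (Q u) = 0)
    (hQ : ∀ u ∈ V, inner ℂ e u = 0 → ‖Q u‖ ≤ θ * ‖u‖)
    (hR : ∀ f g, inner ℂ (R f) g = inner ℂ f (R g)) (hRV : ∀ f ∈ V, R f ∈ V)
    (hRc : ∀ f, ‖R f‖ ^ 2 ≤ c * ‖f‖ ^ 2) (hRe : ‖R e‖ ^ 2 ≤ b) {f : H} (hf : f ∈ V) :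
    ‖R (Q (R f))‖ ≤ ((1 - θ) * b + θ * c) * ‖f‖ := by
  have hee : inner ℂ e e = (1 : ℂ) := by rw [inner_self_eq_norm_sq_to_K, he]; simp
  have hc : 0 ≤ c := by
    have := hRc e
    rw [he] at this
    nlinarith [sq_nonneg ‖R e‖]
  have hb : 0 ≤ b := (sq_nonneg _).trans hRe
  have hpart : ∀ u : H, inner ℂ e (u - inner ℂ e u • e) = 0 := fun u => by
    rw [inner_sub_right, inner_smul_right, hee]; ring
  have hnorm : ∀ u : H, ‖u - inner ℂ e u • e‖ ^ 2 = ‖u‖ ^ 2 - ‖inner ℂ e u‖ ^ 2 := fun u => by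
    have h : inner ℂ (inner ℂ e u • e) (u - inner ℂ e u • e) = 0 := by
      rw [inner_smul_left, hpart, mul_zero]
    have h2 := norm_add_sq_eq_norm_sq_add_norm_sq_of_inner_eq_zero _ _ h
    rw [add_sub_cancel, norm_smul, he, mul_one] at h2
    linarith
  have hcs : ∀ g : H, ‖inner ℂ e (R g)‖ ≤ √b * ‖g‖ := fun g => by
    rw [← hR]
    exact (norm_inner_le_norm _ _).trans
      (mul_le_mul_of_nonneg_right (Real.le_sqrt_of_sq_le hRe) (norm_nonneg _))
  have hcs' : ∀ g : H, ‖R g‖ ≤ √c * ‖g‖ := fun g => by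
    refine le_of_sq_le_sq ?_ (by positivity)
    rw [mul_pow, Real.sq_sqrt hc]
    exact hRc g
  set u := R f with hu
  set g := R (Q u) with hg
  set v := R g with hv
  set x : ℂ := inner ℂ e u with hx
  set y : ℂ := inner ℂ e v with hy
  set u0 := u - x • e with hu0
  set v0 := v - y • e with hv0
  have hu0V : u0 ∈ V := V.sub_mem (hRV f hf) (V.smul_mem _ heV)
  have hQu : Q u = x • e + Q u0 := by
    rw [hu0, map_sub, map_smul, hQe]; abel
  -- Symmetry of `R` moves the outer factor across. Splitting off the `e`-components leaves no cross
  -- term, because `Q u0` is orthogonal to `e`.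
  have hgv : inner ℂ g g = x * inner ℂ v e + inner ℂ v0 (Q u0) := by
    have h1 : inner ℂ g g = inner ℂ v (Q u) := by rw [hv, hR g (Q u)]
    have h2 : inner ℂ v (Q u0) = inner ℂ v0 (Q u0) := by
      rw [hv0, inner_sub_left, inner_smul_left, hQo u0 hu0V (hpart u)]; ring
    rw [h1, hQu, inner_add_right, inner_smul_right, h2]
  have hye : ‖inner ℂ v e‖ = ‖y‖ := norm_inner_symm _ _
  have h1 : ‖g‖ ^ 2 ≤ ‖x‖ * ‖y‖ + θ * (‖u0‖ * ‖v0‖) := by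
    have h2 : ‖inner ℂ g g‖ = ‖g‖ ^ 2 := by rw [inner_self_eq_norm_sq_to_K]; simp
    rw [← h2, hgv]
    refine (norm_add_le _ _).trans (add_le_add ?_ ?_)
    · rw [norm_mul, hye]
    · refine (norm_inner_le_norm _ _).trans ?_
      have := mul_le_mul_of_nonneg_left (hQ u0 hu0V (hpart u)) (norm_nonneg v0)
      linarith
  have hxu : ‖x‖ ≤ ‖u‖ := by simpa [he] using norm_inner_le_norm (𝕜 := ℂ) e u
  have hyv : ‖y‖ ≤ ‖v‖ := by simpa [he] using norm_inner_le_norm (𝕜 := ℂ) e v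
  have hxy : ‖x‖ * ‖y‖ ≤ ‖u‖ * ‖v‖ := mul_le_mul hxu hyv (norm_nonneg _) (norm_nonneg _)
  -- Reverse Cauchy–Schwarz in the plane: `(u² - x²)(v² - y²) ≤ (uv - xy)²`. It makes the final
  -- bound the convex combination `(1-θ)|x||y| + θ‖u‖‖v‖`.
  have h2 : ‖u0‖ * ‖v0‖ ≤ ‖u‖ * ‖v‖ - ‖x‖ * ‖y‖ := by
    refine le_of_sq_le_sq ?_ (by linarith)
    rw [mul_pow, hnorm u, hnorm v]
    nlinarith [sq_nonneg (‖u‖ * ‖y‖ - ‖v‖ * ‖x‖)]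
  have h3 : ‖x‖ * ‖y‖ ≤ b * (‖f‖ * ‖g‖) := by
    refine (mul_le_mul (hcs f) (hcs g) (norm_nonneg _) (by positivity)).trans_eq ?_
    rw [mul_mul_mul_comm, Real.mul_self_sqrt hb]
  have h4 : ‖u‖ * ‖v‖ ≤ c * (‖f‖ * ‖g‖) := by
    refine (mul_le_mul (hcs' f) (hcs' g) (norm_nonneg _) (by positivity)).trans_eq ?_
    rw [mul_mul_mul_comm, Real.mul_self_sqrt hc]
  have h5 : ‖g‖ ^ 2 ≤ ((1 - θ) * b + θ * c) * ‖f‖ * ‖g‖ := by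
    nlinarith [mul_le_mul_of_nonneg_left h2 hθ0, mul_le_mul_of_nonneg_left h3 (sub_nonneg.2 hθ1),
      mul_le_mul_of_nonneg_left h4 hθ0]
  rcases (norm_nonneg g).eq_or_lt with h0 | h0
  · rw [← h0]
    have : 0 ≤ 1 - θ := sub_nonneg.2 hθ1
    positivity
  · rw [sq] at h5
    exact le_of_mul_le_mul_right h5 h0

end hilbert

/-! ### Averaging operators and large deviations for `m` -/

section operators
variable {Y : Type*} {mX mY : MeasurableSpace Y} (hX : mX ≤ mY) {m : Measure Y}
  {S : Y → Y} (hS : MeasurePreserving S m m)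

theorem stateProj_mem (f : Lp ℂ 2 m) : stateProj hX m f ∈ lpMeas ℂ ℂ mX 2 m :=
  Subtype.property _

theorem inner_stateProj_left (f g : Lp ℂ 2 m) :
    inner ℂ (stateProj hX m f) g = inner ℂ f (stateProj hX m g) :=
  inner_condExpL2_left_eq_right hX

theorem stateProj_eq_self {f : Lp ℂ 2 m} (hf : f ∈ lpMeas ℂ ℂ mX 2 m) :
    stateProj hX m f = f := by
  have : Fact (mX ≤ mY) := ⟨hX⟩
  exact Submodule.starProjection_eq_self_iff.2 hf

theorem coeFn_koopman (f : Lp ℂ 2 m) : koopman hS f =ᵐ[m] f ∘ S :=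
  Lp.coeFn_compMeasurePreserving f hS

theorem coeFn_koopman_pow (k : ℕ) (f : Lp ℂ 2 m) : (koopman hS ^ k) f =ᵐ[m] f ∘ S^[k] := by
  induction k with
  | zero => rfl
  | succ k ih =>
    rw [pow_succ', mul_apply_eq_comp]
    refine (coeFn_koopman hS _).trans ?_
    rw [Function.iterate_succ, ← Function.comp_assoc]
    exact hS.quasiMeasurePreserving.ae_eq_comp ih

theorem inner_koopman (f g : Lp ℂ 2 m) : inner ℂ (koopman hS f) (koopman hS g) = inner ℂ f g :=
  (Lp.compMeasurePreservingₗᵢ ℂ S hS).inner_map_map f g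

variable [IsProbabilityMeasure m]

theorem norm_const_one : ‖Lp.const 2 m (1 : ℂ)‖ = 1 := by
  rw [Lp.norm_const] <;> simp

theorem koopman_const : koopman hS (Lp.const 2 m (1 : ℂ)) = Lp.const 2 m (1 : ℂ) := by
  refine Lp.ext ((coeFn_koopman hS _).trans ?_)
  exact (hS.quasiMeasurePreserving.ae_eq_comp (Lp.coeFn_const 2 m (1 : ℂ))).trans
    (Lp.coeFn_const 2 m (1 : ℂ)).symm

theorem const_mem_lpMeas : Lp.const 2 m (1 : ℂ) ∈ lpMeas ℂ ℂ mX 2 m :=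
  mem_lpMeas_iff_aestronglyMeasurable.2
    ((aestronglyMeasurable_const (b := (1 : ℂ))).congr (Lp.coeFn_const 2 m (1 : ℂ)).symm)

omit [IsProbabilityMeasure m] in
theorem averagingOperator_mem (f : Lp ℂ 2 m) :
    averagingOperator hX hS f ∈ lpMeas ℂ ℂ mX 2 m :=
  stateProj_mem hX _

theorem averagingOperator_const :
    averagingOperator hX hS (Lp.const 2 m (1 : ℂ)) = Lp.const 2 m (1 : ℂ) := by
  change stateProj hX m (koopman hS (stateProj hX m _)) = _
  rw [stateProj_eq_self hX const_mem_lpMeas, koopman_const,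
    stateProj_eq_self hX const_mem_lpMeas]

theorem inner_const_averagingOperator {f : Lp ℂ 2 m} (hf : f ∈ lpMeas ℂ ℂ mX 2 m) :
    inner ℂ (Lp.const 2 m (1 : ℂ)) (averagingOperator hX hS f) =
      inner ℂ (Lp.const 2 m (1 : ℂ)) f := by
  change inner ℂ _ (stateProj hX m (koopman hS (stateProj hX m _))) = _
  rw [← inner_stateProj_left, stateProj_eq_self hX hf, stateProj_eq_self hX const_mem_lpMeas]
  nth_rw 1 [← koopman_const hS]
  exact inner_koopman hS _ _

theorem norm_averagingOperator_le {f : Lp ℂ 2 m} (hf : f ∈ lpMeas ℂ ℂ mX 2 m)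
    (hf0 : inner ℂ (Lp.const 2 m (1 : ℂ)) f = 0) :
    ‖averagingOperator hX hS f‖ ≤ averagingNorm hX hS * ‖f‖ := by
  have hf' : f ∈ stateL20 mX m := ⟨hf, Submodule.mem_orthogonal_singleton_iff_inner_right.2 hf0⟩
  exact (averagingOperator hX hS ∘L (stateL20 mX m).subtypeL).le_opNorm ⟨f, hf'⟩

theorem averagingNorm_nonneg : 0 ≤ averagingNorm hX hS := by
  unfold averagingNorm
  positivity

theorem averagingOperator_pow_spec (k : ℕ) {f : Lp ℂ 2 m} (hf : f ∈ lpMeas ℂ ℂ mX 2 m)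
    (hf0 : inner ℂ (Lp.const 2 m (1 : ℂ)) f = 0) :
    (averagingOperator hX hS ^ k) f ∈ lpMeas ℂ ℂ mX 2 m ∧
      inner ℂ (Lp.const 2 m (1 : ℂ)) ((averagingOperator hX hS ^ k) f) = 0 ∧
      ‖(averagingOperator hX hS ^ k) f‖ ≤ averagingNorm hX hS ^ k * ‖f‖ := by
  induction k with
  | zero => exact ⟨hf, hf0, by simp⟩
  | succ k ih =>
    obtain ⟨h1, h2, h3⟩ := ih
    rw [pow_succ', mul_apply_eq_comp]
    refine ⟨averagingOperator_mem hX hS _, ?_, ?_⟩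
    · rw [inner_const_averagingOperator hX hS h1, h2]
    · refine (norm_averagingOperator_le hX hS h1 h2).trans ?_
      rw [pow_succ', mul_assoc]
      exact mul_le_mul_of_nonneg_left h3 (averagingNorm_nonneg hX hS)

theorem averagingOperator_pow_const (k : ℕ) :
    (averagingOperator hX hS ^ k) (Lp.const 2 m (1 : ℂ)) = Lp.const 2 m (1 : ℂ) := by
  induction k with
  | zero => rfl
  | succ k ih => rw [pow_succ, mul_apply_eq_comp, averagingOperator_const, ih]

omit [IsProbabilityMeasure m] in
/-- On the module of property (M), the powers of the averaging operator are the compressions of the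
powers of the Koopman operator. -/
theorem stateProj_koopman_pow {M : Submodule ℂ (Lp ℂ 2 m)}
    (hMU : ∀ f ∈ M, koopman hS f ∈ M)
    (hMP : ∀ f ∈ M, stateProj hX m (koopman hS (stateProj hX m f)) =
      stateProj hX m (koopman hS f)) (k : ℕ) {f : Lp ℂ 2 m} (hf : f ∈ M) :
    (koopman hS ^ k) f ∈ M ∧
    stateProj hX m ((koopman hS ^ k) f) = (averagingOperator hX hS ^ k) (stateProj hX m f) := by
  induction k with
  | zero => exact ⟨hf, rfl⟩
  | succ k ih =>
    rw [pow_succ', pow_succ', mul_apply_eq_comp, mul_apply_eq_comp]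
    refine ⟨hMU _ ih.1, ?_⟩
    rw [← hMP _ ih.1, ih.2]
    change _ = stateProj hX m (koopman hS (stateProj hX m _))
    nth_rw 2 [← ih.2]
    rw [stateProj_eq_self hX (stateProj_mem hX _), ih.2]

/-- Multiplication by a bounded function as an operator on `L²`. -/
noncomputable def mulOperator (g : Lp ℂ ∞ m) : Lp ℂ 2 m →ₗ[ℂ] Lp ℂ 2 m where
  toFun f := g • f
  map_add' := Lp.add_smul g
  map_smul' c f := (Lp.smul_comm c g f).symm

variable {r : Y → ℝ}

omit [IsProbabilityMeasure m] in
theorem coeFn_mulOperator (hr : MemLp (fun y => (r y : ℂ)) ∞ m) (f : Lp ℂ 2 m) :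
    mulOperator (hr.toLp _) f =ᵐ[m] fun y => (r y : ℂ) * f y := by
  refine (Lp.coeFn_lpSMul (r := 2) (hr.toLp _) f).trans ?_
  filter_upwards [hr.coeFn_toLp] with y hy
  simp [hy]

omit [IsProbabilityMeasure m] in
theorem inner_mulOperator (hr : MemLp (fun y => (r y : ℂ)) ∞ m) (f g : Lp ℂ 2 m) :
    inner ℂ (mulOperator (hr.toLp _) f) g = inner ℂ f (mulOperator (hr.toLp _) g) := by
  rw [L2.inner_def, L2.inner_def]
  refine integral_congr_ae ?_
  filter_upwards [coeFn_mulOperator hr f, coeFn_mulOperator hr g] with y hf hg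
  simp only [hf, hg, RCLike.inner_apply, map_mul, Complex.conj_ofReal]
  ring

theorem norm_mulOperator_sq_le (hr : MemLp (fun y => (r y : ℂ)) ∞ m) {c : ℝ}
    (hc : ∀ y, r y ^ 2 ≤ c) (f : Lp ℂ 2 m) :
    ‖mulOperator (hr.toLp _) f‖ ^ 2 ≤ c * ‖f‖ ^ 2 := by
  have hc0 : 0 ≤ c := by
    obtain ⟨y⟩ : Nonempty Y := m.nonempty_of_neZero
    exact (sq_nonneg _).trans (hc y)
  have h : ‖mulOperator (hr.toLp _) f‖ ≤ √c * ‖f‖ := by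
    refine Lp.norm_le_mul_norm_of_ae_le_mul ?_
    filter_upwards [coeFn_mulOperator hr f] with y hy
    rw [hy, norm_mul, Complex.norm_real]
    exact mul_le_mul_of_nonneg_right (Real.abs_le_sqrt (hc y)) (norm_nonneg _)
  calc _ ≤ (√c * ‖f‖) ^ 2 := pow_le_pow_left₀ (norm_nonneg _) h 2
    _ = _ := by rw [mul_pow, Real.sq_sqrt hc0]

theorem norm_mulOperator_const_sq (hr : MemLp (fun y => (r y : ℂ)) ∞ m) :
    ‖mulOperator (hr.toLp _) (Lp.const 2 m (1 : ℂ))‖ ^ 2 = ∫ y, r y ^ 2 ∂m := by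
  have h : inner ℂ (mulOperator (hr.toLp _) (Lp.const 2 m (1 : ℂ)))
      (mulOperator (hr.toLp _) (Lp.const 2 m (1 : ℂ))) = ((∫ y, r y ^ 2 ∂m : ℝ) : ℂ) := by
    rw [L2.inner_def, ← integral_complex_ofReal]
    refine integral_congr_ae ?_
    filter_upwards [coeFn_mulOperator hr (Lp.const 2 m (1 : ℂ)), Lp.coeFn_const 2 m (1 : ℂ)]
      with y hf h1
    simp only [hf, h1, RCLike.inner_apply, Complex.conj_ofReal, Function.const_apply, mul_one]
    push_cast
    ring
  rw [← inner_self_eq_norm_sq (𝕜 := ℂ), h]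
  exact Complex.ofReal_re _

omit [IsProbabilityMeasure m] in
theorem mulOperator_mem_lpMeas (hr : MemLp (fun y => (r y : ℂ)) ∞ m) (hrX : Measurable[mX] r)
    {f : Lp ℂ 2 m} (hf : f ∈ lpMeas ℂ ℂ mX 2 m) :
    mulOperator (hr.toLp _) f ∈ lpMeas ℂ ℂ mX 2 m := by
  rw [mem_lpMeas_iff_aestronglyMeasurable] at hf ⊢
  refine AEStronglyMeasurable.congr ?_ (coeFn_mulOperator hr f).symm
  have : StronglyMeasurable[mX] fun y => (r y : ℂ) :=
    (Complex.measurable_ofReal.comp hrX).stronglyMeasurable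
  exact this.aestronglyMeasurable.mul hf

-- A self-adjoint operator that preserves `L²(X)` commutes with the projection onto it.
omit [IsProbabilityMeasure m] in
theorem stateProj_mulOperator (hr : MemLp (fun y => (r y : ℂ)) ∞ m) (hrX : Measurable[mX] r)
    (f : Lp ℂ 2 m) :
    stateProj hX m (mulOperator (hr.toLp _) f) = mulOperator (hr.toLp _) (stateProj hX m f) := by
  refine ext_inner_left ℂ fun g => ?_
  rw [← inner_stateProj_left, ← inner_mulOperator,
    ← stateProj_eq_self hX (mulOperator_mem_lpMeas hr hrX (stateProj_mem hX g)),
    inner_stateProj_left, inner_mulOperator, inner_stateProj_left,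
    stateProj_eq_self hX (mulOperator_mem_lpMeas hr hrX (stateProj_mem hX f))]

/-- Correlations of a function of the state space along an orbit, under a norm gap. -/
theorem integral_prod_sq_iterate_le (hM : PropertyM hX hS) (hgap : averagingNorm hX hS ≤ 1)
    (hrX : Measurable[mX] r) {b c : ℝ} (hc : ∀ y, r y ^ 2 ≤ c) (hb : ∫ y, r y ^ 2 ∂m ≤ b)
    (k n : ℕ) :
    ∫ y, ∏ i ∈ Finset.range (n + 1), r (S^[k * i] y) ^ 2 ∂m ≤
      ((1 - averagingNorm hX hS ^ k) * b + averagingNorm hX hS ^ k * c) ^ n * b := by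
  obtain ⟨M, -, hMU, hMmul, hXM, hMP⟩ := hM
  have hr : MemLp (fun y => (r y : ℂ)) ∞ m := by
    refine memLp_top_of_bound (C := √c)
      (Complex.measurable_ofReal.comp (hrX.mono hX le_rfl)).aestronglyMeasurable
      (Eventually.of_forall fun y => ?_)
    rw [Complex.norm_real]
    exact Real.abs_le_sqrt (hc y)
  set e := Lp.const 2 m (1 : ℂ) with he
  set R := mulOperator (hr.toLp _) with hR
  set A := ((1 - averagingNorm hX hS ^ k) * b + averagingNorm hX hS ^ k * c) with hA
  have hb0 : 0 ≤ b := (integral_nonneg fun y => sq_nonneg (r y)).trans hb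
  have hc0 : 0 ≤ c := by
    obtain ⟨y⟩ : Nonempty Y := m.nonempty_of_neZero
    exact (sq_nonneg _).trans (hc y)
  have hlam0 := averagingNorm_nonneg hX hS
  have hA0 : 0 ≤ A := by
    have : 0 ≤ 1 - averagingNorm hX hS ^ k := sub_nonneg.2 (pow_le_one₀ hlam0 hgap)
    positivity
  have hRM : ∀ f ∈ M, R f ∈ M := fun f hf => by
    refine hMmul _ ?_ f hf
    refine AEStronglyMeasurable.congr ?_ hr.coeFn_toLp.symm
    exact (Complex.measurable_ofReal.comp hrX).stronglyMeasurable.aestronglyMeasurable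
  have hRe : ‖R e‖ ^ 2 ≤ b := (norm_mulOperator_const_sq hr).trans_le hb
  have heV : e ∈ lpMeas ℂ ℂ mX 2 m := const_mem_lpMeas
  have hstep : ∀ g ∈ lpMeas ℂ ℂ mX 2 m,
      ‖R ((averagingOperator hX hS ^ k) (R g))‖ ≤ A * ‖g‖ := fun g hg =>
    norm_compression_le (Q := (averagingOperator hX hS ^ k).toLinearMap) (R := R)
      norm_const_one heV (averagingOperator_pow_const hX hS k) (pow_nonneg hlam0 k)
      (pow_le_one₀ hlam0 hgap)
      (fun u hu hu0 => (averagingOperator_pow_spec hX hS k hu hu0).2.1)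
      (fun u hu hu0 => (averagingOperator_pow_spec hX hS k hu hu0).2.2)
      (inner_mulOperator hr) (fun f hf => mulOperator_mem_lpMeas hr hrX hf)
      (norm_mulOperator_sq_le hr hc) hRe hg
  -- The recursion is `g ↦ R U^k R g`, starting at `R e`. Only the projection of `g` to `L²(X)` is
  -- controlled: there property (M) replaces `U^k` by `T^k`. One factor `R` is kept in reserve, so
  -- that every step has the symmetric form `R T^k R`.
  obtain ⟨g, hgM, hgP, hg⟩ : ∃ g ∈ M, ‖stateProj hX m g‖ ≤ A ^ n * ‖R e‖ ∧
      (R g : Lp ℂ 2 m) =ᵐ[m]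
        fun y => ((∏ i ∈ Finset.range (n + 1), r (S^[k * i] y) ^ 2 : ℝ) : ℂ) := by
    induction n with
    | zero =>
      refine ⟨R e, hRM _ (hXM heV), ?_, ?_⟩
      · rw [stateProj_eq_self hX (mulOperator_mem_lpMeas hr hrX heV), pow_zero, one_mul]
      · filter_upwards [coeFn_mulOperator hr (R e), coeFn_mulOperator hr e,
          Lp.coeFn_const 2 m (1 : ℂ)] with y h1 h2 h3
        rw [h1, h2, h3]
        simp [sq]
    | succ n ih =>
      obtain ⟨g, hgM, hgP, hg⟩ := ih
      have hk := stateProj_koopman_pow hX hS hMU hMP k (hRM g hgM)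
      refine ⟨R ((koopman hS ^ k) (R g)), hRM _ hk.1, ?_, ?_⟩
      · rw [stateProj_mulOperator hX hr hrX, hk.2, stateProj_mulOperator hX hr hrX]
        refine (hstep _ (stateProj_mem hX g)).trans ?_
        rw [pow_succ', mul_assoc]
        exact mul_le_mul_of_nonneg_left hgP hA0
      · filter_upwards [coeFn_mulOperator hr (R ((koopman hS ^ k) (R g))),
          coeFn_mulOperator hr ((koopman hS ^ k) (R g)), coeFn_koopman_pow hS k (R g),
          (hS.iterate k).quasiMeasurePreserving.ae_eq_comp hg] with y h1 h2 h3 h4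
        rw [h1, h2, h3, h4, Finset.prod_range_succ']
        simp only [Function.comp_apply, mul_zero, Function.iterate_zero, id]
        push_cast
        have h5 : ∀ i, S^[k * (i + 1)] y = S^[k * i] (S^[k] y) := fun i => by
          rw [mul_add, mul_one, Function.iterate_add_apply]
        simp only [h5]
        ring
  have hint : inner ℂ e (R g) =
      ((∫ y, ∏ i ∈ Finset.range (n + 1), r (S^[k * i] y) ^ 2 ∂m : ℝ) : ℂ) := by
    rw [L2.inner_def, ← integral_complex_ofReal]
    refine integral_congr_ae ?_
    filter_upwards [hg, Lp.coeFn_const 2 m (1 : ℂ)] with y h1 h2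
    rw [h1, h2]
    simp
  have hle : ‖inner ℂ e (R g)‖ ≤ ‖R e‖ * (A ^ n * ‖R e‖) := by
    rw [← inner_mulOperator, ← stateProj_eq_self hX (mulOperator_mem_lpMeas hr hrX heV),
      inner_stateProj_left, stateProj_eq_self hX (mulOperator_mem_lpMeas hr hrX heV)]
    exact (norm_inner_le_norm _ _).trans (mul_le_mul_of_nonneg_left hgP (norm_nonneg _))
  rw [hint, Complex.norm_real] at hle
  refine (le_abs_self _).trans (hle.trans ?_)
  calc ‖R e‖ * (A ^ n * ‖R e‖) = A ^ n * ‖R e‖ ^ 2 := by ring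
    _ ≤ _ := mul_le_mul_of_nonneg_left hRe (pow_nonneg hA0 n)

/-- Large deviations for a bounded function of the state space, under a norm gap. -/
theorem measureReal_le_exp_neg_binaryKL (hM : PropertyM hX hS) (hgap : averagingNorm hX hS ≤ 1)
    {ψ : Y → ℝ} (hψX : Measurable[mX] ψ) (hψ : ∀ y, ψ y ∈ Set.Icc (0 : ℝ) 1) (k n : ℕ)
    {θ δ p : ℝ} (hθ : θ = averagingNorm hX hS ^ k) (hδ : δ = θ + (1 - θ) * ∫ y, ψ y ∂m)
    (hδ0 : 0 < δ) (hδp : δ < p) (hp : p < 1) :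
    m.real {y | n * p ≤ ∑ i ∈ Finset.range n, ψ (S^[k * i] y)} ≤
      Real.exp (-(n * binaryKL p δ)) := by
  have hp0 : 0 < p := hδ0.trans hδp
  have hp1 : 0 < 1 - p := sub_pos.2 hp
  have hδ1 : 0 < 1 - δ := by linarith
  -- `x = e^β` for the optimal `β` in the Chernoff bound for Bernoulli trials of parameter `δ`.
  set x : ℝ := p * (1 - δ) / (δ * (1 - p)) with hx
  have hx1 : 1 < x := by
    rw [hx, one_lt_div (by positivity)]; nlinarith
  have hx0 : 0 < x := one_pos.trans hx1
  set β := Real.log x with hβ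
  have hβ0 : 0 < β := Real.log_pos hx1
  have hexp : Real.exp β = x := Real.exp_log hx0
  have hθ0 : 0 ≤ θ := hθ ▸ pow_nonneg (averagingNorm_nonneg hX hS) k
  have hθ1 : θ ≤ 1 := hθ ▸ pow_le_one₀ (averagingNorm_nonneg hX hS) hgap
  have hψint : Integrable ψ m := by
    refine Integrable.of_bound (hψX.mono hX le_rfl).aestronglyMeasurable 1
      (Eventually.of_forall fun y => ?_)
    rw [Real.norm_of_nonneg (hψ y).1]
    exact (hψ y).2
  have hq0 : 0 ≤ ∫ y, ψ y ∂m := integral_nonneg fun y => (hψ y).1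
  have hq1 : ∫ y, ψ y ∂m ≤ 1 := by
    have := integral_mono hψint (integrable_const 1) fun y => (hψ y).2
    simpa using this
  have hw0 : ∀ y, 1 ≤ 1 + (x - 1) * ψ y := fun y => by
    nlinarith [(hψ y).1]
  set r : Y → ℝ := fun y => √(1 + (x - 1) * ψ y) with hrdef
  have hr2 : ∀ y, r y ^ 2 = 1 + (x - 1) * ψ y := fun y =>
    Real.sq_sqrt (zero_le_one.trans (hw0 y))
  have hrX : Measurable[mX] r := Real.continuous_sqrt.measurable.comp
    (measurable_const.add (measurable_const.mul hψX))
  have hb : ∫ y, r y ^ 2 ∂m = 1 + (x - 1) * ∫ y, ψ y ∂m := by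
    simp only [hr2]
    rw [integral_add (integrable_const _) (hψint.const_mul _), integral_const_mul]
    simp
  have hprod : ∫ y, ∏ i ∈ Finset.range n, r (S^[k * i] y) ^ 2 ∂m ≤ (1 + (x - 1) * δ) ^ n := by
    cases n with
    | zero => simp
    | succ n =>
      have h := integral_prod_sq_iterate_le hX hS hM hgap hrX (c := x)
        (fun y => by rw [hr2]; nlinarith [(hψ y).2]) hb.le k n
      refine h.trans ?_
      rw [← hθ]
      -- The weight is affine in `ψ`, so the compression bound is exactly the mean weight of a
      -- Bernoulli variable of parameter `δ`.
      have h1 : (1 - θ) * (1 + (x - 1) * ∫ y, ψ y ∂m) + θ * x = 1 + (x - 1) * δ := by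
        rw [hδ]; ring
      rw [h1, pow_succ]
      refine mul_le_mul_of_nonneg_left ?_ (pow_nonneg ?_ n)
      · have : ∫ y, ψ y ∂m ≤ δ := by rw [hδ]; nlinarith
        nlinarith
      · nlinarith
  have hpt : ∀ y, Real.exp (β * ∑ i ∈ Finset.range n, ψ (S^[k * i] y)) ≤
      ∏ i ∈ Finset.range n, r (S^[k * i] y) ^ 2 := fun y => by
    rw [Finset.mul_sum, Real.exp_sum]
    refine Finset.prod_le_prod (fun i _ => (Real.exp_pos _).le) fun i _ => ?_
    rw [hr2]
    set s := ψ (S^[k * i] y)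
    have hs := hψ (S^[k * i] y)
    -- On `[0, 1]` the convex function `s ↦ e^{βs}` lies below its chord `1 + (x - 1)s`.
    have hcv := convexOn_exp.2 (Set.mem_univ 0) (Set.mem_univ β) (sub_nonneg.2 hs.2) hs.1
      (by ring)
    simp only [smul_eq_mul, mul_zero, zero_add, Real.exp_zero, mul_one, hexp] at hcv
    rw [mul_comm β]
    linarith
  have hmeas : ∀ i, Measurable fun y => r (S^[k * i] y) ^ 2 := fun i =>
    ((hrX.mono hX le_rfl).comp (hS.iterate _).measurable).pow_const 2
  have hint : Integrable (fun y => ∏ i ∈ Finset.range n, r (S^[k * i] y) ^ 2) m := by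
    refine Integrable.of_bound (Finset.measurable_prod _ fun i _ => hmeas i).aestronglyMeasurable
      (x ^ n) (Eventually.of_forall fun y => ?_)
    rw [Real.norm_of_nonneg (Finset.prod_nonneg fun i _ => sq_nonneg _)]
    refine (Finset.prod_le_prod (fun i _ => sq_nonneg _) fun i _ => ?_).trans_eq
      (b := ∏ i ∈ Finset.range n, x) (by simp)
    rw [hr2]
    nlinarith [(hψ (S^[k * i] y)).2]
  have hsub : {y | n * p ≤ ∑ i ∈ Finset.range n, ψ (S^[k * i] y)} ⊆
      {y | Real.exp (β * (n * p)) ≤ ∏ i ∈ Finset.range n, r (S^[k * i] y) ^ 2} := fun y hy =>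
    (Real.exp_le_exp.2 (mul_le_mul_of_nonneg_left hy hβ0.le)).trans (hpt y)
  have hmarkov := mul_meas_ge_le_integral_of_nonneg (μ := m)
    (Eventually.of_forall fun y => Finset.prod_nonneg fun i _ => sq_nonneg (r (S^[k * i] y))) hint
    (Real.exp (β * (n * p)))
  have h1 : 1 + (x - 1) * δ = (1 - δ) / (1 - p) := by
    rw [hx]; field_simp; ring
  have hD : -(n * binaryKL p δ) = n * Real.log ((1 - δ) / (1 - p)) - β * (n * p) := by
    have h2 : Real.log x = -Real.log (δ / p) + Real.log ((1 - δ) / (1 - p)) := by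
      rw [← Real.log_inv, inv_div, ← Real.log_mul (by positivity) (by positivity), hx]
      congr 1
      field_simp
    rw [hβ, h2, binaryKL]; ring
  have h3 : Real.exp (-(n * binaryKL p δ)) =
      (1 + (x - 1) * δ) ^ n / Real.exp (β * (n * p)) := by
    rw [hD, Real.exp_sub, h1, Real.exp_nat_mul, Real.exp_log (by positivity)]
  rw [h3, le_div_iff₀ (Real.exp_pos _), mul_comm]
  refine le_trans ?_ (hmarkov.trans hprod)
  exact mul_le_mul_of_nonneg_left (measureReal_mono hsub) (Real.exp_pos _).le

end operators

/-! ### Bowen sets in the group -/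

section bowenSets
variable {G : Type*} [Group G] {a : G} {B B' : Set G} {s t : ℤ}

theorem mem_bowen {g : G} :
    g ∈ bowen a B s t ↔ ∀ i : ℤ, s ≤ i → i ≤ t → a ^ i * g * a ^ (-i) ∈ B := by
  refine forall₃_congr fun i _ _ => ⟨?_, fun h => ⟨_, h, by group⟩⟩
  rintro ⟨b, hb, rfl⟩
  convert hb using 1
  group

theorem bowen_mono (h : B ⊆ B') : bowen a B s t ⊆ bowen a B' s t := fun _ hg =>
  mem_bowen.2 fun i hi hi' => h (mem_bowen.1 hg i hi hi')

theorem bowen_subset (hs : s ≤ 0) (ht : 0 ≤ t) : bowen a B s t ⊆ B := fun g hg => by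
  simpa using mem_bowen.1 hg 0 hs ht

theorem bowen_mul_subset : bowen a B s t * bowen a B' s t ⊆ bowen a (B * B') s t := by
  rintro _ ⟨g, hg, g', hg', rfl⟩
  refine mem_bowen.2 fun i hi hi' => ⟨_, mem_bowen.1 hg i hi hi', _, mem_bowen.1 hg' i hi hi', ?_⟩
  simp only
  group

theorem bowen_inv : (bowen a B s t)⁻¹ = bowen a B⁻¹ s t := by
  ext g
  simp only [Set.mem_inv, mem_bowen]
  refine forall₃_congr fun i _ _ => ?_
  rw [show a ^ i * g⁻¹ * a ^ (-i) = (a ^ i * g * a ^ (-i))⁻¹ by group]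

theorem one_mem_bowen (h : (1 : G) ∈ B) : (1 : G) ∈ bowen a B s t :=
  mem_bowen.2 fun i _ _ => by simpa using h

variable [TopologicalSpace G] [IsTopologicalGroup G]

theorem bowen_mem_nhds_one (hB : B ∈ 𝓝 (1 : G)) : bowen a B s t ∈ 𝓝 (1 : G) := by
  have : bowen a B s t = ⋂ i ∈ Set.Icc s t, {g | a ^ i * g * a ^ (-i) ∈ B} := by
    ext g
    simp [mem_bowen]
  rw [this, biInter_mem (Set.finite_Icc s t)]
  intro i _
  have hc : Continuous fun g : G => a ^ i * g * a ^ (-i) := by fun_prop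
  exact hc.tendsto' 1 1 (by group) hB

theorem isClosed_bowen (hB : IsClosed B) : IsClosed (bowen a B s t) := by
  have : bowen a B s t = ⋂ i, ⋂ (_ : s ≤ i), ⋂ (_ : i ≤ t), {g | a ^ i * g * a ^ (-i) ∈ B} := by
    ext g
    simp [mem_bowen]
  rw [this]
  refine isClosed_iInter fun i => isClosed_iInter fun _ => isClosed_iInter fun _ => ?_
  exact hB.preimage (by fun_prop : Continuous fun g : G => a ^ i * g * a ^ (-i))

theorem isCompact_bowen [T2Space G] (hB : IsCompact B) (hs : s ≤ 0) (ht : 0 ≤ t) :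
    IsCompact (bowen a B s t) :=
  hB.of_isClosed_subset (isClosed_bowen hB.isClosed) (bowen_subset hs ht)

end bowenSets

/-! ### Volume of Bowen balls in `Γ\G` -/

section orbitSets
variable {G Y : Type*} [Group G] [TopologicalSpace G] [TopologicalSpace Y] [MulAction G Y]
  [ContinuousSMul G Y]

theorem IsCompact.image_smul_const {F : Set G} (hF : IsCompact F) (y : Y) :
    IsCompact ((fun g : G => g • y) '' F) :=
  hF.image (by fun_prop)

/-- The relation of lying in the same orbit of a compact set is closed. -/
theorem isClosed_setOf_mem_image_smul [T2Space Y] {F : Set G} (hF : IsCompact F) :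
    IsClosed {p : Y × Y | p.2 ∈ (fun g : G => g • p.1) '' F} := by
  have : CompactSpace F := isCompact_iff_compactSpace.1 hF
  have h : IsClosed {q : F × (Y × Y) | (q.1 : G) • q.2.1 = q.2.2} :=
    isClosed_eq (by fun_prop) (by fun_prop)
  convert isClosedMap_snd_of_compactSpace _ h using 1
  ext p
  constructor
  · rintro ⟨g, hg, h⟩
    exact ⟨(⟨g, hg⟩, p), h, rfl⟩
  · rintro ⟨q, hq, rfl⟩
    exact ⟨q.1, q.1.2, hq⟩

theorem measurable_measure_image_smul [T2Space Y] [SecondCountableTopology Y] [MeasurableSpace Y]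
    [BorelSpace Y] {F : Set G} (hF : IsCompact F) (ν : Measure Y) [SFinite ν] :
    Measurable fun y => ν ((fun g : G => g • y) '' F) :=
  measurable_measure_prodMk_left (isClosed_setOf_mem_image_smul hF).measurableSet

variable [IsTopologicalGroup G] [SecondCountableTopology G] [LocallyCompactSpace G] [T2Space G]
  [MeasurableSpace G] [BorelSpace G] [T2Space Y] [SecondCountableTopology Y] [MeasurableSpace Y]
  [BorelSpace Y] {m : Measure Y} [IsProbabilityMeasure m] [SMulInvariantMeasure G Y m]
  (η : Measure G) [η.IsHaarMeasure] {F V W : Set G}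

/-- Fubini for the translates by `F` of the piece `V • y` of an orbit. -/
theorem haar_mul_measure_eq_lintegral (hF : IsCompact F) (hV : IsCompact V) (y : Y) :
    η F * m ((fun g : G => g • y) '' V) =
      ∫⁻ z, η {g | g ∈ F ∧ g⁻¹ • z ∈ (fun g : G => g • y) '' V} ∂m := by
  set A : Set (G × Y) := {p | p.1 ∈ F ∧ p.1⁻¹ • p.2 ∈ (fun g : G => g • y) '' V} with hA
  have hAm : MeasurableSet A := by
    refine IsClosed.measurableSet ((hF.isClosed.preimage continuous_fst).inter ?_)
    exact (hV.image_smul_const y).isClosed.preimage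
      (by fun_prop : Continuous fun p : G × Y => p.1⁻¹ • p.2)
  have h1 : (η.prod m) A = η F * m ((fun g : G => g • y) '' V) := by
    rw [Measure.prod_apply hAm]
    have : ∀ g, m (Prod.mk g ⁻¹' A) =
        F.indicator (fun _ => m ((fun g : G => g • y) '' V)) g := fun g => by
      by_cases hg : g ∈ F
      · rw [Set.indicator_of_mem hg,
          ← measure_preimage_smul g⁻¹ (μ := m) ((fun g : G => g • y) '' V)]
        congr 1
        ext z
        simp [hA, hg]
      · simp [hA, hg]
    simp only [this]
    rw [lintegral_indicator hF.measurableSet]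
    simp [mul_comm]
  rw [← h1, Measure.prod_apply_symm hAm]
  rfl

/-- In the Fubini identity, injectivity writes each `z` in the larger orbit piece as `x • y` with a
unique `x` in `F * V`. The admissible `g` then lie in `x V⁻¹`, of Haar measure `η V⁻¹`. -/
theorem haar_mul_measure_image_le (hF : IsCompact F) (hV : IsCompact V) {y : Y}
    (hinj : Set.InjOn (fun g : G => g • y) (F * V)) :
    η F * m ((fun g : G => g • y) '' V) ≤ η V⁻¹ * m ((fun g : G => g • y) '' (F * V)) := by
  rw [haar_mul_measure_eq_lintegral η hF hV,
    ← lintegral_indicator_const ((hF.mul hV).image_smul_const y).measurableSet]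
  refine lintegral_mono fun z => ?_
  by_cases hz : z ∈ (fun g : G => g • y) '' (F * V)
  · rw [Set.indicator_of_mem hz]
    obtain ⟨x, hx, rfl⟩ := hz
    rw [← measure_smul (μ := η) x V⁻¹]
    refine measure_mono ?_
    rintro g ⟨hg, v, hv, hgv⟩
    have h1 : (g * v) • y = x • y := by
      rw [mul_smul]
      exact smul_eq_iff_eq_inv_smul g |>.2 hgv
    have h2 : g * v = x := hinj (Set.mul_mem_mul hg hv) hx h1
    exact ⟨v⁻¹, Set.inv_mem_inv.2 hv, by simp [← h2]⟩
  · rw [Set.indicator_of_notMem hz, nonpos_iff_eq_zero]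
    convert measure_empty (μ := η)
    refine Set.eq_empty_of_forall_notMem ?_
    rintro g ⟨hg, v, hv, hgv⟩
    refine hz ⟨g * v, Set.mul_mem_mul hg hv, ?_⟩
    simp only [mul_smul]
    exact smul_eq_iff_eq_inv_smul g |>.2 hgv

/-- The same identity read from below: for `z = w • y` all of `w V⁻¹` is admissible, and injectivity
plays no role. -/
theorem haar_inv_mul_measure_image_le (hF : IsCompact F) (hV : IsCompact V) (hW : IsCompact W)
    (h : W * V⁻¹ ⊆ F) (y : Y) :
    η V⁻¹ * m ((fun g : G => g • y) '' W) ≤ η F * m ((fun g : G => g • y) '' V) := by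
  rw [haar_mul_measure_eq_lintegral η hF hV,
    ← lintegral_indicator_const (hW.image_smul_const y).measurableSet]
  refine lintegral_mono fun z => ?_
  by_cases hz : z ∈ (fun g : G => g • y) '' W
  · rw [Set.indicator_of_mem hz]
    obtain ⟨w, hw, rfl⟩ := hz
    rw [← measure_smul (μ := η) w V⁻¹]
    refine measure_mono ?_
    rintro _ ⟨v, hv, rfl⟩
    refine ⟨h (Set.mul_mem_mul hw hv), v⁻¹, hv, ?_⟩
    simp [mul_smul]
  · rw [Set.indicator_of_notMem hz]
    exact zero_le

end orbitSets

section volume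
attribute [local instance] RightCosetSpace.continuousSMul

variable {G : Type*} [Group G] [TopologicalSpace G] [IsTopologicalGroup G] [T2Space G]
  [LocallyCompactSpace G] [SecondCountableTopology G] {Γ : Subgroup G} [DiscreteTopology Γ]
  {m : Measure (RightCosetSpace Γ)} [IsProbabilityMeasure m]
  [SMulInvariantMeasure G (RightCosetSpace Γ) m]

theorem measure_image_smul_pos {W : Set G} (hW : W ∈ 𝓝 (1 : G)) (y : RightCosetSpace Γ) :
    0 < m ((fun g : G => g • y) '' W) := by
  have : MulAction.IsPretransitive G (RightCosetSpace Γ) :=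
    ⟨RightCosetSpace.exists_smul_eq⟩
  have : m.IsOpenPosMeasure := ⟨fun U hU hne =>
    (measure_isOpen_pos_of_smulInvariant_of_ne_zero G (IsProbabilityMeasure.ne_zero m) hU hne).ne'⟩
  exact Measure.measure_pos_of_mem_nhds m (RightCosetSpace.image_smul_mem_nhds hW y)

theorem exists_le_measure_image_smul {Ω : Set (RightCosetSpace Γ)} (hΩ : IsCompact Ω) {W : Set G}
    (hW : W ∈ 𝓝 (1 : G)) :
    ∃ κ : ℝ, 0 < κ ∧ ∀ y ∈ Ω, ENNReal.ofReal κ ≤ m ((fun g : G => g • y) '' W) := by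
  refine hΩ.induction_on (p := fun Ω => ∃ κ : ℝ, 0 < κ ∧
    ∀ y ∈ Ω, ENNReal.ofReal κ ≤ m ((fun g : G => g • y) '' W)) ?_ ?_ ?_ ?_
  · exact ⟨1, one_pos, by simp⟩
  · rintro s t hst ⟨κ, h0, h⟩
    exact ⟨κ, h0, fun y hy => h y (hst hy)⟩
  · rintro s t ⟨κ, h0, h⟩ ⟨κ', h0', h'⟩
    refine ⟨min κ κ', lt_min h0 h0', ?_⟩
    rintro y (hy | hy)
    · exact (ENNReal.ofReal_le_ofReal (min_le_left _ _)).trans (h y hy)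
    · exact (ENNReal.ofReal_le_ofReal (min_le_right _ _)).trans (h' y hy)
  · intro y _
    -- For `z = w • y` near `y`, the set `W • z` contains `W' • y`, so the volume at `y` serves a
    -- whole neighborhood.
    obtain ⟨W', hW', hWW⟩ : ∃ W' ∈ 𝓝 (1 : G), ∀ v ∈ W', ∀ w ∈ W', v / w ∈ W :=
      exists_nhds_split_inv hW
    have hpos := measure_image_smul_pos (m := m) hW' y
    refine ⟨_, mem_nhdsWithin_of_mem_nhds (RightCosetSpace.image_smul_mem_nhds hW' y),
      (m ((fun g : G => g • y) '' W')).toReal, ENNReal.toReal_pos hpos.ne' (measure_ne_top _ _), ?_⟩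
    rintro _ ⟨w, hw, rfl⟩
    rw [ENNReal.ofReal_toReal (measure_ne_top _ _)]
    refine measure_mono ?_
    rintro _ ⟨v, hv, rfl⟩
    exact ⟨v / w, hWW v hv w hw, by simp [div_eq_mul_inv, mul_smul]⟩

/-- Lower bound for the volume of Bowen balls centered in a compact set. -/
theorem exists_le_measure_bowenBall [MeasurableSpace G] [BorelSpace G] {a : G}
    (hhom : IsHaarHomogeneous m a) {h : ℝ} (h0 : 0 ≤ h)
    (hm : measureEntropy m (fun y => a • y) < ENNReal.ofReal h)
    {Ω : Set (RightCosetSpace Γ)} (hΩ : IsCompact Ω) {U : Set G} (hU : U ∈ 𝓝 (1 : G))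
    (hinj : ∀ y ∈ Ω, Set.InjOn (fun g : G => g • y) U) :
    ∃ c : ℝ, 0 < c ∧ ∀ y ∈ Ω, ∀ s t : ℤ, s ≤ 0 → 0 ≤ t →
      ENNReal.ofReal (c * Real.exp (-h * ((t : ℝ) - s + 1))) ≤ m (bowenBall a U s t y) := by
  obtain ⟨B₀, hB₀, hBU⟩ := exists_nhds_one_split hU
  obtain ⟨B, hB, hBB₀, hBc⟩ := local_compact_nhds hB₀
  obtain ⟨B', -, hB'B, C, hC, hCB⟩ := hhom h h0 hm B hB
  obtain ⟨κ, hκ, hκΩ⟩ := exists_le_measure_image_smul (m := m) hΩ hB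
  set η : Measure G := Measure.haar
  have hFc : IsCompact (B * B⁻¹) := hBc.mul hBc.inv
  have hFpos : 0 < η (B * B⁻¹) := by
    refine Measure.measure_pos_of_mem_nhds η (x := 1) (mem_of_superset hB fun g hg => ?_)
    exact ⟨g, hg, 1, by simpa using mem_of_mem_nhds hB, by simp⟩
  have hFtop : η (B * B⁻¹) ≠ ∞ := hFc.measure_lt_top.ne
  refine ⟨C * κ / (η (B * B⁻¹)).toReal, by
    have := ENNReal.toReal_pos hFpos.ne' hFtop
    positivity, fun y hy s t hs ht => ?_⟩
  set V := bowen a B s t with hV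
  have hVc : IsCompact V := isCompact_bowen hBc hs ht
  have hVU : V * V ⊆ bowen a U s t := bowen_mul_subset.trans (bowen_mono (by
    rintro _ ⟨v, hv, w, hw, rfl⟩
    exact hBU v (hBB₀ hv) w (hBB₀ hw)))
  have h1 := haar_mul_measure_image_le (m := m) η hVc hVc (y := y)
    ((hinj y hy).mono (hVU.trans (bowen_subset hs ht)))
  have h2 := haar_inv_mul_measure_image_le (m := m) η hFc hVc hBc
    (Set.mul_subset_mul_left (Set.inv_subset_inv.2 (bowen_subset hs ht))) y
  have hVpos : η V⁻¹ ≠ 0 :=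
    (Measure.measure_pos_of_mem_nhds η (inv_mem_nhds_one G (bowen_mem_nhds_one hB))).ne'
  have hVtop : η V⁻¹ ≠ ∞ := hVc.inv.measure_lt_top.ne
  have h3 : ENNReal.ofReal (C * Real.exp (-h * ((t : ℝ) - s + 1))) ≤ η V :=
    (hCB s t hs ht).trans (measure_mono (bowen_mono hB'B))
  -- The two volume comparisons both carry the factor `η V⁻¹`, which cancels; hence left and right
  -- Haar measure need not be compared.
  have h4 : η V⁻¹ * (η V * ENNReal.ofReal κ) ≤
      η V⁻¹ * (η (B * B⁻¹) * m (bowenBall a U s t y)) :=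
    calc η V⁻¹ * (η V * ENNReal.ofReal κ)
        ≤ η V * (η V⁻¹ * m ((fun g : G => g • y) '' B)) := by
          rw [mul_left_comm]
          gcongr
          exact hκΩ y hy
      _ ≤ η V * (η (B * B⁻¹) * m ((fun g : G => g • y) '' V)) := by gcongr
      _ = η (B * B⁻¹) * (η V * m ((fun g : G => g • y) '' V)) := mul_left_comm _ _ _
      _ ≤ η (B * B⁻¹) * (η V⁻¹ * m ((fun g : G => g • y) '' (V * V))) := by gcongr
      _ ≤ η (B * B⁻¹) * (η V⁻¹ * m (bowenBall a U s t y)) := by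
          gcongr
          exact Set.image_mono hVU
      _ = _ := mul_left_comm _ _ _
  have h5 := (ENNReal.mul_le_mul_iff_right hVpos hVtop).1 h4
  have h6 : ENNReal.ofReal (C * Real.exp (-h * ((t : ℝ) - s + 1))) * ENNReal.ofReal κ ≤
      η (B * B⁻¹) * m (bowenBall a U s t y) := (mul_le_mul_left h3 _).trans h5
  rw [show C * κ / (η (B * B⁻¹)).toReal * Real.exp (-h * ((t : ℝ) - s + 1)) =
    (C * Real.exp (-h * ((t : ℝ) - s + 1))) * κ / (η (B * B⁻¹)).toReal by ring,
    ENNReal.ofReal_div_of_pos (ENNReal.toReal_pos hFpos.ne' hFtop),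
    ENNReal.ofReal_mul (by positivity), ENNReal.ofReal_toReal hFtop]
  exact ENNReal.div_le_of_le_mul' h6

end volume

/-! ### Packing disjoint balls -/

section packing
variable {Y : Type*} [MeasurableSpace Y]

/-- Greedy choice: as long as the balls `E` around the chosen points have total mass less than `ν
Z`, some point of `Z` lies outside them all. -/
theorem exists_finset_pairwiseDisjoint (ν : Measure Y) [IsFiniteMeasure ν] {Z : Set Y}
    {D E : Y → Set Y} (hDE : ∀ y ∈ Z, ∀ z ∈ Z, z ∉ E y → Disjoint (D y) (D z))
    (hE : ∀ y ∈ Z, y ∈ E y) {b : ℝ} (hb : 0 ≤ b) (hEb : ∀ y ∈ Z, ν.real (E y) ≤ b) (N : ℕ)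
    (hN : (N : ℝ) * b < ν.real Z + b) :
    ∃ s : Finset Y, s.card = N ∧ (s : Set Y) ⊆ Z ∧ (s : Set Y).PairwiseDisjoint D := by
  classical
  induction N with
  | zero => exact ⟨∅, by simp⟩
  | succ N ih =>
    push_cast at hN
    obtain ⟨s, hs, hsZ, hsD⟩ := ih (by nlinarith)
    obtain ⟨z, hz, hzs⟩ : ∃ z ∈ Z, z ∉ ⋃ y ∈ s, E y := by
      by_contra! hcon
      have h1 : ν.real Z ≤ ∑ y ∈ s, ν.real (E y) :=
        (measureReal_mono hcon (measure_ne_top _ _)).trans (measureReal_biUnion_finset_le s E)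
      have h2 : ∑ y ∈ s, ν.real (E y) ≤ N * b := by
        rw [← hs, ← nsmul_eq_mul]
        exact Finset.sum_le_card_nsmul _ _ _ fun y hy => hEb y (hsZ hy)
      nlinarith
    simp only [Set.mem_iUnion, not_exists] at hzs
    have hzs' : z ∉ s := fun hzs' => hzs z hzs' (hE z hz)
    refine ⟨insert z s, by simp [hzs', hs], ?_, ?_⟩
    · rw [Finset.coe_insert]
      exact Set.insert_subset hz hsZ
    · rw [Finset.coe_insert, Set.pairwiseDisjoint_insert_of_notMem (by exact_mod_cast hzs')]
      exact ⟨hsD, fun y hy => (hDE y (hsZ hy) z hz (hzs y hy)).symm⟩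

/-- A set that contains many disjoint pieces of a given volume has a large volume; the number of
pieces is bounded from below by the average mass of balls. -/
theorem le_measureReal_of_lintegral_le (ν m : Measure Y) [IsFiniteMeasure ν] [IsFiniteMeasure m]
    {Ω Z Z' : Set Y} (hZΩ : Z ⊆ Ω) {D E : Y → Set Y}
    (hDE : ∀ y ∈ Z, ∀ z ∈ Z, z ∉ E y → Disjoint (D y) (D z)) (hE : ∀ y ∈ Z, y ∈ E y)
    (hEm : Measurable fun y => ν (E y)) (hDm : ∀ y ∈ Z, MeasurableSet (D y))
    (hDZ : ∀ y ∈ Z, D y ⊆ Z') {β η κ : ℝ} (hβ : 0 < β) (hη : 0 < η)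
    (hEβ : ∫⁻ y in Ω, ν (E y) ∂ν ≤ ENNReal.ofReal β) (hZη : η ≤ ν.real Z)
    (hκ : 0 ≤ κ) (hDκ : ∀ y ∈ Z, κ ≤ m.real (D y)) : η ^ 2 / (4 * β) * κ ≤ m.real Z' := by
  -- With this threshold, Markov's inequality discards at most half of the mass `η`; the rest needs
  -- at least `(η / 2) / b` balls.
  set b := 2 * β / η with hb
  have hb0 : 0 < b := by positivity
  set T := {y | ENNReal.ofReal b ≤ ν (E y)} with hT
  have hTm : MeasurableSet T := measurableSet_le measurable_const hEm
  have h1 : ν.real (T ∩ Ω) ≤ η / 2 := by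
    have h := mul_meas_ge_le_lintegral (μ := ν.restrict Ω) hEm (ENNReal.ofReal b)
    rw [Measure.restrict_apply hTm] at h
    have h' := ENNReal.toReal_mono ENNReal.ofReal_ne_top (h.trans hEβ)
    rw [ENNReal.toReal_mul, ENNReal.toReal_ofReal hb0.le, ENNReal.toReal_ofReal hβ.le] at h'
    change b * ν.real (T ∩ Ω) ≤ β at h'
    rw [hb, div_mul_eq_mul_div, div_le_iff₀ hη] at h'
    nlinarith
  have h2 : η / 2 ≤ ν.real (Z \ T) := by
    have h3 : ν.real Z ≤ ν.real (T ∩ Ω) + ν.real (Z \ T) := by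
      refine (measureReal_mono fun y hy => ?_).trans (measureReal_union_le _ _)
      by_cases hyT : y ∈ T
      · exact Or.inl ⟨hyT, hZΩ hy⟩
      · exact Or.inr ⟨hy, hyT⟩
    linarith
  have hsub : Z \ T ⊆ Z := Set.sdiff_subset
  obtain ⟨s, hs, hsZ, hsD⟩ := exists_finset_pairwiseDisjoint ν (Z := Z \ T) (D := D) (E := E)
    (fun y hy z hz => hDE y (hsub hy) z (hsub hz)) (fun y hy => hE y (hsub hy)) hb0.le
    (fun y hy => ENNReal.toReal_le_of_le_ofReal hb0.le (not_le.1 hy.2).le)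
    ⌈ν.real (Z \ T) / b⌉₊ (by
      have := Nat.ceil_lt_add_one (div_nonneg (measureReal_nonneg (μ := ν) (s := Z \ T)) hb0.le)
      have h4 := mul_lt_mul_of_pos_right this hb0
      rwa [add_mul, div_mul_cancel₀ _ hb0.ne', one_mul] at h4)
  have h5 : η ^ 2 / (4 * β) ≤ s.card := by
    rw [hs]
    refine le_trans ?_ (Nat.le_ceil _)
    rw [le_div_iff₀ hb0]
    refine le_trans (le_of_eq ?_) h2
    rw [hb]
    field_simp
    ring
  calc η ^ 2 / (4 * β) * κ ≤ s.card * κ := mul_le_mul_of_nonneg_right h5 hκ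
    _ = ∑ _y ∈ s, κ := by simp
    _ ≤ ∑ y ∈ s, m.real (D y) := Finset.sum_le_sum fun y hy => hDκ y (hsub (hsZ hy))
    _ = m.real (⋃ y ∈ s, D y) :=
      (measureReal_biUnion_finset hsD fun y hy => hDm y (hsub (hsZ hy))).symm
    _ ≤ _ := measureReal_mono (Set.iUnion₂_subset fun y hy => hDZ y (hsub (hsZ hy)))

end packing

/-! ### Packing against large deviations -/

section core
attribute [local instance] RightCosetSpace.continuousSMul

variable {G : Type*} [Group G] [TopologicalSpace G] [IsTopologicalGroup G] [T2Space G]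
  [LocallyCompactSpace G] [SecondCountableTopology G] {Γ : Subgroup G} [DiscreteTopology Γ]

omit [T2Space G] [LocallyCompactSpace G] [SecondCountableTopology G] [DiscreteTopology Γ] in
theorem integral_comp_zpow_smul {a : G} {ν : Measure (RightCosetSpace Γ)}
    (hν : MeasurePreserving (fun y : RightCosetSpace Γ => a • y) ν ν) (j : ℤ)
    (ψ : RightCosetSpace Γ → ℝ) : ∫ y, ψ (a ^ j • y) ∂ν = ∫ y, ψ y ∂ν := by
  have h1 : MeasurePreserving (fun y : RightCosetSpace Γ => a⁻¹ • y) ν ν :=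
    MeasurePreserving.symm (MeasurableEquiv.smul a) hν
  have hpow : ∀ b : G, MeasurePreserving (fun y : RightCosetSpace Γ => b • y) ν ν →
      ∀ n : ℕ, MeasurePreserving (fun y : RightCosetSpace Γ => b ^ n • y) ν ν := fun b hb n => by
    have := hb.iterate n
    rwa [smul_iterate] at this
  have h2 : MeasurePreserving (fun y : RightCosetSpace Γ => a ^ j • y) ν ν := by
    obtain ⟨n, rfl | rfl⟩ := j.eq_nat_or_neg
    · simpa using hpow a hν n
    · simpa using hpow a⁻¹ h1 n
  exact h2.integral_comp (MeasurableEquiv.smul (a ^ j)).measurableEmbedding ψ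

omit [T2Space G] [LocallyCompactSpace G] [SecondCountableTopology G] [DiscreteTopology Γ] in
/-- An invariant measure gives mass to the points whose finite ergodic average is not much smaller
than the mean. -/
theorem lt_measureReal_le_sum {a : G} {ν : Measure (RightCosetSpace Γ)} [IsProbabilityMeasure ν]
    (hν : MeasurePreserving (fun y : RightCosetSpace Γ => a • y) ν ν)
    {ψ : RightCosetSpace Γ → ℝ} (hψc : Continuous ψ) (hψ : ∀ y, ψ y ∈ Set.Icc (0 : ℝ) 1)
    {n : ℕ} (hn : 0 < n) (j : ℕ → ℤ) {p ε : ℝ} (hp : 0 ≤ p) (hpε : p + ε < ∫ y, ψ y ∂ν) :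
    ε < ν.real {y | n * p ≤ ∑ i ∈ Finset.range n, ψ (a ^ j i • y)} := by
  set E := {y | n * p ≤ ∑ i ∈ Finset.range n, ψ (a ^ j i • y)} with hE
  have hcont : ∀ i, Continuous fun y : RightCosetSpace Γ => ψ (a ^ j i • y) := fun i => by fun_prop
  have hEm : MeasurableSet E := (isClosed_le continuous_const
    (continuous_finsetSum _ fun i _ => hcont i)).measurableSet
  have hint : ∀ i, Integrable (fun y : RightCosetSpace Γ => ψ (a ^ j i • y)) ν := fun i =>
    Integrable.of_bound (hcont i).measurable.aestronglyMeasurable 1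
      (Eventually.of_forall fun y => by
        rw [Real.norm_of_nonneg (hψ _).1]
        exact (hψ _).2)
  have h1 : ∫ y, ∑ i ∈ Finset.range n, ψ (a ^ j i • y) ∂ν = n * ∫ y, ψ y ∂ν := by
    rw [integral_finsetSum _ fun i _ => hint i]
    simp [integral_comp_zpow_smul hν]
  have h2 : ∫ y, ∑ i ∈ Finset.range n, ψ (a ^ j i • y) ∂ν ≤
      ∫ y, (E.indicator (fun _ => (n : ℝ)) y + n * p) ∂ν := by
    refine integral_mono (integrable_finsetSum _ fun i _ => hint i)
      (((integrable_const _).indicator hEm).add (integrable_const _)) fun y => ?_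
    by_cases hy : y ∈ E
    · have h3 : ∑ i ∈ Finset.range n, ψ (a ^ j i • y) ≤ n := by
        simpa using Finset.sum_le_card_nsmul (Finset.range n) _ 1
          fun i _ => (hψ (a ^ j i • y)).2
      simp only [Set.indicator_of_mem hy]
      have : 0 ≤ n * p := by positivity
      linarith
    · simp only [Set.indicator_of_notMem hy, zero_add]
      exact (not_le.1 hy).le
  rw [h1, integral_add ((integrable_const _).indicator hEm) (integrable_const _),
    integral_indicator_const _ hEm] at h2
  simp only [smul_eq_mul, integral_const, probReal_univ, one_mul] at h2
  have hn' : (0 : ℝ) < n := by exact_mod_cast hn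
  nlinarith

variable [MeasurableSpace G] [BorelSpace G]
  {m : Measure (RightCosetSpace Γ)} [IsProbabilityMeasure m]
  [SMulInvariantMeasure G (RightCosetSpace Γ) m] {K : Subgroup G} {a : G}

/-- The divergence bound for compactly supported continuous functions, below the limiting mean. -/
theorem binaryKL_le_of_hasCompactSupport
    (hgap : averagingNorm (stateAlgebra_le Γ K) (measurePreserving_smul a m) ≤ 1)
    (hM : PropertyM (stateAlgebra_le Γ K) (measurePreserving_smul a m))
    (hhom : IsHaarHomogeneous m a)
    {μs : ℕ → Measure (RightCosetSpace Γ)} [∀ i, IsProbabilityMeasure (μs i)]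
    (hinv : ∀ i, MeasurePreserving (fun y : RightCosetSpace Γ => a • y) (μs i) (μs i))
    {h : ℝ} {F : Set (Set (RightCosetSpace Γ))} (hFc : ∀ Ω ∈ F, IsCompact Ω)
    (hFmass : ∀ ε : ℝ, 0 < ε → ∃ Ω ∈ F,
      ENNReal.ofReal (1 - ε) ≤ limsup (fun i => μs i Ω) atTop)
    (hFbowen : ∀ Ω ∈ F, ∃ B ∈ 𝓝 (1 : G), ∃ t : ℕ → ℕ, (∀ i, 0 < t i) ∧ Tendsto t atTop atTop ∧
      ∃ C : ℝ, 0 < C ∧ ∀ i,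
        ∫⁻ y in Ω, μs i (bowenBall a B (-(t i : ℤ)) (t i) y) ∂(μs i) ≤
          ENNReal.ofReal (C * Real.exp (-2 * h * t i)))
    {ψ : RightCosetSpace Γ → ℝ} (hψc : Continuous ψ) (hψs : HasCompactSupport ψ)
    (hψ : ∀ y, ψ y ∈ Set.Icc (0 : ℝ) 1) (hψX : Measurable[stateAlgebra Γ K] ψ)
    {P : ℝ} (hP : P ≤ 1) (hlim : Tendsto (fun i => ∫ y, ψ y ∂(μs i)) atTop (𝓝 P))
    {k : ℕ} (hk : 1 ≤ k) {θ δ p : ℝ}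
    (hθ : θ = averagingNorm (stateAlgebra_le Γ K) (measurePreserving_smul a m) ^ k)
    (hδ : δ = θ + (1 - θ) * ∫ y, ψ y ∂m) (hδ0 : 0 < δ) (hδp : δ < p) (hpP : p < P)
    {h' : ℝ} (h0' : 0 ≤ h') (hm : measureEntropy m (fun y => a • y) < ENNReal.ofReal h') :
    binaryKL p δ ≤ k * (h' - h) := by
  by_contra! hcon
  set d := binaryKL p δ with hd
  have hk0 : (0 : ℝ) < k := by exact_mod_cast hk
  obtain ⟨ε, hε, hε4⟩ : ∃ ε : ℝ, 0 < ε ∧ 4 * ε ≤ P - p := ⟨(P - p) / 4, by linarith, by linarith⟩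
  have hp0 : 0 < p := hδ0.trans hδp
  obtain ⟨N, hN, hNψ⟩ := exists_nhds_abs_smul_sub_lt (G := G) hψc hψs hε
  obtain ⟨Ω, hΩF, hΩ⟩ := hFmass (ε / 2) (half_pos hε)
  obtain ⟨B, hB, t, -, htop, C, hC, hCB⟩ := hFbowen Ω hΩF
  obtain ⟨I, hI, hIinj⟩ := RightCosetSpace.exists_nhds_injOn_smul (hFc Ω hΩF)
  have hdiv : Tendsto (fun q : G × G => q.1⁻¹ * q.2) (𝓝 1 ×ˢ 𝓝 1) (𝓝 1) := by
    rw [← nhds_prod_eq]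
    exact Continuous.tendsto' (by fun_prop) _ _ (by simp)
  -- If two `U`-balls meet, one centre lies in the `U⁻¹U`-ball of the other. So `U`-balls are
  -- packed, while `B`-balls carry the mass hypothesis.
  obtain ⟨U₀, hU₀, hU₀B⟩ := mem_prod_self_iff.1 (hdiv hB)
  obtain ⟨U, hU, hUsub, hUc⟩ := local_compact_nhds (inter_mem (inter_mem hI hN) hU₀)
  have hUB : U⁻¹ * U ⊆ B := by
    rintro _ ⟨x, hx, y, hy, rfl⟩
    have := hU₀B (Set.mk_mem_prod (hUsub hx).2 (hUsub hy).2)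
    simpa using this
  obtain ⟨c, hc, hcΩ⟩ := exists_le_measure_bowenBall (m := m) hhom h0' hm (hFc Ω hΩF) hU
    fun y hy => (hIinj y hy).mono fun g hg => (hUsub hg).1.1
  have h1U : (1 : G) ∈ U := mem_of_mem_nhds hU
  -- the bound at a single large time
  have hkey : ∀ i, 1 - ε < (μs i).real Ω → p + 3 * ε < ∫ y, ψ y ∂(μs i) → k ≤ 2 * t i →
      ε ^ 2 / (4 * (C * Real.exp (-2 * h * t i))) * (c * Real.exp (-h' * (2 * t i + 1))) ≤
        Real.exp (-(2 * t i / k * d) + |d|) := by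
    intro i hiΩ hiψ hki
    set T := t i with hT
    set n := 2 * T / k with hn
    have hn0 : 0 < n := Nat.div_pos hki hk
    have hnk : k * n ≤ 2 * T := Nat.mul_div_le _ _
    -- Sampling times spaced by `k`, starting at `-T` and staying in the window of the Bowen ball.
    set j : ℕ → ℤ := fun l => (k * l : ℕ) + (-(T : ℤ)) with hj
    have hjT : ∀ l ∈ Finset.range n, -(T : ℤ) ≤ j l ∧ j l ≤ T := fun l hl => by
      have h1 : k * l ≤ k * n := Nat.mul_le_mul_left k (Finset.mem_range.1 hl).le
      simp only [hj]
      omega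
    set E := {y | n * (p + ε) ≤ ∑ l ∈ Finset.range n, ψ (a ^ j l • y)} with hE
    set E' := {y | n * p ≤ ∑ l ∈ Finset.range n, ψ (a ^ j l • y)} with hE'
    have hEmass : 2 * ε < (μs i).real E :=
      lt_measureReal_le_sum (hinv i) hψc hψ hn0 j (by linarith) (by linarith)
    have hZ : ε ≤ (μs i).real (Ω ∩ E) := by
      have h1 := measureReal_union_add_inter' (μ := μs i) (hFc Ω hΩF).measurableSet (t := E)
      have h2 : (μs i).real (Ω ∪ E) ≤ 1 := measureReal_le_one
      linarith
    have hE'le : m.real E' ≤ Real.exp (-(n * d)) := by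
      have h1 := measureReal_le_exp_neg_binaryKL (stateAlgebra_le Γ K)
        (measurePreserving_smul a m) hM hgap hψX hψ k n hθ hδ hδ0 hδp (hpP.trans_le hP)
      refine le_trans (le_of_eq ?_) h1
      -- The deviation bound concerns forward orbits from time `0`; invariance of `m` shifts the
      -- window to start at `-T`.
      have h2 : E' = (fun y => a ^ (-(T : ℤ)) • y) ⁻¹' {y | n * p ≤
          ∑ l ∈ Finset.range n, ψ ((fun y : RightCosetSpace Γ => a • y)^[k * l] y)} := by
        ext y
        simp only [hE', Set.mem_preimage, Set.mem_ofPred_eq, smul_iterate, hj, zpow_add, mul_smul,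
          zpow_natCast]
      rw [h2, measureReal_def, measure_preimage_smul, measureReal_def]
    have hpack := le_measureReal_of_lintegral_le (μs i) m (Ω := Ω) (Z := Ω ∩ E) (Z' := E')
      (D := bowenBall a U (-(T : ℤ)) T) (E := bowenBall a (U⁻¹ * U) (-(T : ℤ)) T)
      (β := C * Real.exp (-2 * h * T)) (η := ε) (κ := c * Real.exp (-h' * (2 * T + 1)))
      Set.inter_subset_left ?_ ?_ ?_ ?_ ?_ (by positivity) hε ?_ hZ (by positivity) ?_
    · refine hpack.trans (hE'le.trans (Real.exp_le_exp.2 ?_))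
      -- Rounding `2T / k` down to `n` costs at most `|d|` in the exponent, whatever the sign of
      -- `d`.
      have h1 : (2 * T / k : ℝ) - 1 ≤ n := by
        have := Nat.lt_div_mul_add (a := 2 * T) hk
        have h2 : (2 * T : ℝ) < n * k + k := by exact_mod_cast this
        rw [sub_le_iff_le_add, div_le_iff₀ hk0]
        linarith
      have h2 : (n : ℝ) ≤ 2 * T / k := by
        rw [le_div_iff₀ hk0]
        exact_mod_cast (mul_comm n k).trans_le hnk
      have h3 : (2 * T / k - n : ℝ) * d ≤ 1 * |d| :=
        (le_abs_self _).trans (by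
          rw [abs_mul]
          exact mul_le_mul_of_nonneg_right (abs_le.2 ⟨by linarith, by linarith⟩) (abs_nonneg _))
      linarith
    · intro y _ z _ hz
      rw [Set.disjoint_left]
      rintro _ ⟨f, hf, rfl⟩ ⟨g, hg, hgf⟩
      refine hz ⟨g⁻¹ * f, bowen_mul_subset (Set.mul_mem_mul ?_ hf), ?_⟩
      · rw [← bowen_inv]
        exact Set.inv_mem_inv.2 hg
      · simp only at hgf ⊢
        rw [mul_smul, ← hgf, inv_smul_smul]
    · intro y _
      exact ⟨1, one_mem_bowen ⟨1, by simpa using h1U, 1, h1U, by simp⟩, one_smul _ _⟩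
    · exact measurable_measure_image_smul
        (isCompact_bowen (hUc.inv.mul hUc) (by omega) (by omega)) (μs i)
    · intro y _
      exact ((isCompact_bowen hUc (by omega) (by omega)).image_smul_const y).measurableSet
    · rintro y ⟨-, hy⟩ _ ⟨f, hf, rfl⟩
      -- At each sampling time the orbits of `f • y` and `y` differ by an element of `U`, so `ψ`
      -- drops by less than `ε`. This uses up the gap between the thresholds `p + ε` and `p`.
      have h1 : ∀ l ∈ Finset.range n, ψ (a ^ j l • y) - ε ≤ ψ (a ^ j l • f • y) := fun l hl => by
        have h2 := mem_bowen.1 hf (j l) (hjT l hl).1 (hjT l hl).2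
        have h3 := hNψ _ (hUsub h2).1.2 (a ^ j l • y)
        rw [smul_smul, mul_assoc, ← zpow_add, neg_add_cancel, zpow_zero, mul_one, mul_smul] at h3
        linarith [(abs_lt.1 h3).1]
      have h2 := Finset.sum_le_sum h1
      rw [Finset.sum_sub_distrib] at h2
      simp only [Finset.sum_const, Finset.card_range, nsmul_eq_mul] at h2
      have h3 : n * (p + ε) ≤ ∑ l ∈ Finset.range n, ψ (a ^ j l • y) := hy
      change n * p ≤ ∑ l ∈ Finset.range n, ψ (a ^ j l • f • y)
      linarith
    · refine (lintegral_mono fun y => ?_).trans (hCB i)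
      exact measure_mono (Set.image_mono (bowen_mono hUB))
    · rintro y ⟨hy, -⟩
      have h1 := hcΩ y hy (-(T : ℤ)) T (by omega) (by omega)
      rw [ENNReal.ofReal_le_iff_le_toReal (measure_ne_top _ _)] at h1
      refine le_trans (le_of_eq ?_) h1
      push_cast
      ring_nf
  -- The upper limit gives large mass of `Ω` only infinitely often. This suffices, as the other
  -- requirements on `i` hold eventually.
  have hfreq : ∃ᶠ i in atTop, ENNReal.ofReal (1 - ε) < μs i Ω := by
    refine frequently_lt_of_lt_limsup (by isBoundedDefault) (lt_of_lt_of_le ?_ hΩ)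
    exact (ENNReal.ofReal_lt_ofReal_iff (by linarith)).2 (by linarith)
  set L := 2 * (d / k - (h' - h)) with hL
  have hL0 : 0 < L := by
    have : h' - h < d / k := by rwa [lt_div_iff₀' hk0]
    linarith
  set c₀ := Real.log (ε ^ 2 / (4 * C) * c) with hc₀
  have ht' : Tendsto (fun i => (t i : ℝ)) atTop atTop := tendsto_natCast_atTop_atTop.comp htop
  obtain ⟨i, hi1, hi2, hi3, hi4⟩ := (hfreq.and_eventually
    ((hlim.eventually (lt_mem_nhds (show p + 3 * ε < P by linarith))).and
      ((htop.eventually (eventually_ge_atTop k)).and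
        ((ht'.const_mul_atTop hL0).eventually
          (eventually_gt_atTop (|d| + h' - c₀)))))).exists
  have hi1' : 1 - ε < (μs i).real Ω :=
    (ENNReal.ofReal_lt_iff_lt_toReal (by linarith) (measure_ne_top _ _)).1 hi1
  have h1 := hkey i hi1' hi2 (by omega)
  have h2 : ε ^ 2 / (4 * (C * Real.exp (-2 * h * t i))) * (c * Real.exp (-h' * (2 * t i + 1))) =
      Real.exp (c₀ + 2 * h * t i - h' * (2 * t i + 1)) := by
    rw [Real.exp_sub, Real.exp_add, Real.exp_log (by positivity),
      show -2 * h * (t i : ℝ) = -(2 * h * t i) by ring,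
      show -h' * (2 * (t i : ℝ) + 1) = -(h' * (2 * t i + 1)) by ring, Real.exp_neg, Real.exp_neg]
    field_simp
  rw [h2, Real.exp_le_exp] at h1
  have h3 : L * t i = 2 * t i / k * d - h' * (2 * t i) + 2 * h * t i := by
    rw [hL]; ring
  linarith

end core

/-! ### Passage to the limit and the two cases -/

theorem binaryKL_one_sub (p q : ℝ) : binaryKL (1 - p) (1 - q) = binaryKL p q := by
  simp only [binaryKL, sub_sub_cancel]
  ring

theorem Filter.Tendsto.binaryKL {ι : Type*} {l : Filter ι} {u v : ι → ℝ} {p q : ℝ}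
    (hu : Tendsto u l (𝓝 p)) (hv : Tendsto v l (𝓝 q)) (hp0 : p ≠ 0) (hp1 : p ≠ 1) (hq0 : q ≠ 0)
    (hq1 : q ≠ 1) : Tendsto (fun i => binaryKL (u i) (v i)) l (𝓝 (binaryKL p q)) := by
  have hp1' : 1 - p ≠ 0 := sub_ne_zero.2 hp1.symm
  have hq1' : 1 - q ≠ 0 := sub_ne_zero.2 hq1.symm
  refine Tendsto.sub (hu.neg.mul ((hv.div hu hp0).log (div_ne_zero hq0 hp0))) ?_
  exact (hu.const_sub 1).mul
    (((hv.const_sub 1).div (hu.const_sub 1) hp1').log (div_ne_zero hq1' hp1'))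

/-- For finite entropy, `h'` is taken as `H + ε / k` with `ε → 0`, and `log (λ^k) = k log λ` cancels
the factor `k`. Infinite entropy makes the right side `⊤`. -/
theorem coe_div_neg_log_le {H : ℝ≥0∞} {D h lam : ℝ} {k : ℕ} (hk : 1 ≤ k) (h0 : 0 < lam)
    (h1 : lam < 1)
    (hD : ∀ h' : ℝ, 0 ≤ h' → H < ENNReal.ofReal h' → D ≤ k * (h' - h)) :
    ((D / (-Real.log (lam ^ k)) : ℝ) : EReal) ≤
      ((H : EReal) - (h : EReal)) / ((-Real.log lam : ℝ) : EReal) := by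
  have hL : 0 < -Real.log lam := neg_pos.2 (Real.log_neg h0 h1)
  have hk0 : (0 : ℝ) < k := by exact_mod_cast hk
  induction H with
  | top =>
    rw [EReal.coe_ennreal_top, EReal.top_sub_coe,
      EReal.top_div_of_pos_ne_top (by exact_mod_cast hL) (EReal.coe_ne_top _)]
    exact le_top
  | coe r =>
    have hr : D ≤ k * ((r : ℝ) - h) := by
      refine le_of_forall_pos_le_add fun ε hε => ?_
      have := hD (r + ε / k) (by positivity) (by
        rw [← ENNReal.ofReal_coe_nnreal]
        exact (ENNReal.ofReal_lt_ofReal_iff (by positivity)).2 (by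
          have : 0 < ε / k := by positivity
          linarith))
      refine this.trans_eq ?_
      field_simp
      ring
    have hcoe : (((r : ℝ≥0∞) : EReal)) = ((r : ℝ) : EReal) := rfl
    rw [hcoe, ← EReal.coe_sub, ← EReal.coe_div, EReal.coe_le_coe_iff, Real.log_pow,
      ← mul_neg, div_le_div_iff₀ (by positivity) hL]
    nlinarith [mul_le_mul_of_nonneg_right hr hL.le]

section divergence
attribute [local instance] RightCosetSpace.continuousSMul

variable {G : Type*} [Group G] [TopologicalSpace G] [IsTopologicalGroup G] [T2Space G]
  [LocallyCompactSpace G] [SecondCountableTopology G] {Γ : Subgroup G} [DiscreteTopology Γ]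
  [MeasurableSpace G] [BorelSpace G]
  {m : Measure (RightCosetSpace Γ)} [IsProbabilityMeasure m]
  [SMulInvariantMeasure G (RightCosetSpace Γ) m] {K : Subgroup G} {a : G}

/-- The divergence bound for functions whose mean increases in the limit. -/
theorem binaryKL_le_of_lt (hK : IsCompact (K : Set G)) {lam : ℝ}
    (hlam : lam = averagingNorm (stateAlgebra_le Γ K) (measurePreserving_smul a m))
    (hlam0 : 0 < lam) (hgap : lam < 1)
    (hM : PropertyM (stateAlgebra_le Γ K) (measurePreserving_smul a m))
    (hhom : IsHaarHomogeneous m a)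
    {μs : ℕ → Measure (RightCosetSpace Γ)} [∀ i, IsProbabilityMeasure (μs i)]
    (hinv : ∀ i, MeasurePreserving (fun y : RightCosetSpace Γ => a • y) (μs i) (μs i))
    {μ : Measure (RightCosetSpace Γ)} [IsProbabilityMeasure μ]
    (hlim : ∀ f : RightCosetSpace Γ → ℝ, Continuous f → HasCompactSupport f →
      Tendsto (fun i => ∫ y, f y ∂(μs i)) atTop (𝓝 (∫ y, f y ∂μ)))
    {h : ℝ} {F : Set (Set (RightCosetSpace Γ))} (hFc : ∀ Ω ∈ F, IsCompact Ω)
    (hFmass : ∀ ε : ℝ, 0 < ε → ∃ Ω ∈ F,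
      ENNReal.ofReal (1 - ε) ≤ limsup (fun i => μs i Ω) atTop)
    (hFbowen : ∀ Ω ∈ F, ∃ B ∈ 𝓝 (1 : G), ∃ t : ℕ → ℕ, (∀ i, 0 < t i) ∧ Tendsto t atTop atTop ∧
      ∃ C : ℝ, 0 < C ∧ ∀ i,
        ∫⁻ y in Ω, μs i (bowenBall a B (-(t i : ℤ)) (t i) y) ∂(μs i) ≤
          ENNReal.ofReal (C * Real.exp (-2 * h * t i)))
    {φ : RightCosetSpace Γ → ℝ} (hφ01 : ∀ y, φ y ∈ Set.Icc (0 : ℝ) 1)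
    (hφX : Measurable[stateAlgebra Γ K] φ)
    (hφ : Continuous φ ∨ ∃ A : Set (StateSpace Γ K), (IsClosed A ∨ IsOpen A) ∧
      φ = (stateMap Γ K ⁻¹' A).indicator (fun _ => (1 : ℝ)))
    (h1 : ∫ y, φ y ∂μ < 1) (hlt : ∫ y, φ y ∂m < ∫ y, φ y ∂μ) {k : ℕ} (hk : 1 ≤ k)
    (hθ : lam ^ k < ((∫ y, φ y ∂μ) - ∫ y, φ y ∂m) / (1 - ∫ y, φ y ∂m))
    {h' : ℝ} (h0' : 0 ≤ h') (hm : measureEntropy m (fun y => a • y) < ENNReal.ofReal h') :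
    binaryKL (∫ y, φ y ∂μ) (lam ^ k + (1 - lam ^ k) * ∫ y, φ y ∂m) ≤ k * (h' - h) := by
  obtain ⟨ψ, hψc, hψs, hψ01, hψX, hψφ⟩ := exists_tendsto_stateAlgebra hK hφ01 hφX hφ
  set θ := lam ^ k with hθdef
  have hθ0 : 0 < θ := pow_pos hlam0 k
  have hθ1 : θ < 1 := pow_lt_one₀ hlam0.le hgap (by omega)
  have hdom : ∀ ν : Measure (RightCosetSpace Γ), IsProbabilityMeasure ν →
      Tendsto (fun n => ∫ y, ψ n y ∂ν) atTop (𝓝 (∫ y, φ y ∂ν)) := fun ν _ =>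
    tendsto_integral_of_dominated_convergence (fun _ => 1)
      (fun n => (hψc n).measurable.aestronglyMeasurable) (integrable_const _)
      (fun n => Eventually.of_forall fun y => by
        rw [Real.norm_of_nonneg (hψ01 n y).1]
        exact (hψ01 n y).2) (Eventually.of_forall hψφ)
  set p := ∫ y, φ y ∂μ with hp
  set q := ∫ y, φ y ∂m with hq
  have hq0 : 0 ≤ q := integral_nonneg fun y => (hφ01 y).1
  have hδ0 : 0 < θ + (1 - θ) * q := by nlinarith
  have hδp : θ + (1 - θ) * q < p := by
    rw [lt_div_iff₀ (by linarith)] at hθ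
    linarith
  -- Subtracting `1 / (n + 1)` keeps the threshold strictly below the limiting mean of `ψ n`, as the
  -- bound for compactly supported functions demands.
  have hu : Tendsto (fun n : ℕ => ∫ y, ψ n y ∂μ - 1 / ((n : ℝ) + 1)) atTop (𝓝 p) := by
    simpa using (hdom μ inferInstance).sub tendsto_one_div_add_atTop_nhds_zero_nat
  have hv : Tendsto (fun n => θ + (1 - θ) * ∫ y, ψ n y ∂m) atTop (𝓝 (θ + (1 - θ) * q)) :=
    ((hdom m inferInstance).const_mul _).const_add _
  refine le_of_tendsto (hu.binaryKL hv (by linarith) h1.ne hδ0.ne' (by linarith)) ?_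
  filter_upwards [hv.eventually_lt hu hδp] with n hn
  have hψq : 0 ≤ ∫ y, ψ n y ∂m := integral_nonneg fun y => (hψ01 n y).1
  refine binaryKL_le_of_hasCompactSupport (hlam ▸ hgap.le) hM hhom hinv hFc hFmass hFbowen
    (hψc n) (hψs n) (hψ01 n) (hψX n) ?_ (hlim _ (hψc n) (hψs n)) hk (hlam ▸ hθdef) rfl
    (by nlinarith) hn ?_ h0' hm
  · refine (integral_mono_of_nonneg (Eventually.of_forall fun y => (hψ01 n y).1)
      (integrable_const 1) (Eventually.of_forall fun y => (hψ01 n y).2)).trans_eq (by simp)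
  · have : (0 : ℝ) < 1 / ((n : ℝ) + 1) := by positivity
    linarith

end divergence

theorem mainTheorem5
    {G : Type*} [Group G] [TopologicalSpace G] [IsTopologicalGroup G] [T2Space G]
    [LocallyCompactSpace G] [SecondCountableTopology G] [MeasurableSpace G] [BorelSpace G]
    -- the lattice `Γ` and the invariant probability measure `m` on `Y = Γ\G`
    (Γ : Subgroup G) [DiscreteTopology Γ]
    (m : Measure (RightCosetSpace Γ)) [IsProbabilityMeasure m]
    [SMulInvariantMeasure G (RightCosetSpace Γ) m]
    -- the state space `X = Y/K`
    (K : Subgroup G) (hK : IsCompact (K : Set G))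
    (hN : IsOpen (Subgroup.normalizer (K : Set G) : Set G))
    (a : G)
    -- norm gap, property (M), homogeneity of the Haar measure
    (lam : ℝ)
    (hlam : lam = averagingNorm (stateAlgebra_le Γ K) (measurePreserving_smul a m))
    (hgap : lam < 1)
    (hM : PropertyM (stateAlgebra_le Γ K) (measurePreserving_smul a m))
    (hhom : IsHaarHomogeneous m a)
    -- the `a`-invariant measures `μᵢ` and their weak-* limit `μ`
    (μs : ℕ → Measure (RightCosetSpace Γ)) [∀ i, IsProbabilityMeasure (μs i)]
    (hinv : ∀ i, MeasurePreserving (fun y : RightCosetSpace Γ => a • y) (μs i) (μs i))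
    (μ : Measure (RightCosetSpace Γ)) [IsProbabilityMeasure μ]
    (hlim : ∀ f : RightCosetSpace Γ → ℝ, Continuous f → HasCompactSupport f →
      Tendsto (fun i => ∫ y, f y ∂(μs i)) atTop (𝓝 (∫ y, f y ∂μ)))
    (h : ℝ) (hh : 0 < h)
    -- the family of compact sets
    (F : Set (Set (RightCosetSpace Γ))) (hFc : ∀ Ω ∈ F, IsCompact Ω)
    (hFmass : ∀ ε : ℝ, 0 < ε → ∃ Ω ∈ F,
      ENNReal.ofReal (1 - ε) ≤ limsup (fun i => μs i Ω) atTop)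
    -- the average mass of Bowen balls on each of them
    (hFbowen : ∀ Ω ∈ F, ∃ B ∈ 𝓝 (1 : G), ∃ t : ℕ → ℕ, (∀ i, 0 < t i) ∧ Tendsto t atTop atTop ∧
      ∃ C : ℝ, 0 < C ∧ ∀ i,
        ∫⁻ y in Ω, μs i (bowenBall a B (-(t i : ℤ)) (t i) y) ∂(μs i) ≤
          ENNReal.ofReal (C * Real.exp (-2 * h * t i)))
    -- the test function
    (φ : RightCosetSpace Γ → ℝ) (hφ01 : ∀ y, φ y ∈ Set.Icc (0 : ℝ) 1)
    (hφX : Measurable[stateAlgebra Γ K] φ)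
    (hφ : Continuous φ ∨ ∃ A : Set (StateSpace Γ K), (IsClosed A ∨ IsOpen A) ∧
      φ = (stateMap Γ K ⁻¹' A).indicator (fun _ => (1 : ℝ))) :
    ((∫ y, φ y ∂μ) < 1 → (∫ y, φ y ∂m) < ∫ y, φ y ∂μ →
      ∀ θ ∈ {θ : ℝ | ∃ k : ℕ, 1 ≤ k ∧ θ = lam ^ k},
        θ < ((∫ y, φ y ∂μ) - ∫ y, φ y ∂m) / (1 - ∫ y, φ y ∂m) →
        ((binaryKL (∫ y, φ y ∂μ) (θ + (1 - θ) * ∫ y, φ y ∂m) / (-Real.log θ) : ℝ) : EReal) ≤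
          ((measureEntropy m (fun y => a • y) : EReal) - (h : EReal)) /
            ((-Real.log lam : ℝ) : EReal)) ∧
    (0 < (∫ y, φ y ∂μ) → (∫ y, φ y ∂μ) < ∫ y, φ y ∂m →
      ∀ θ ∈ {θ : ℝ | ∃ k : ℕ, 1 ≤ k ∧ θ = lam ^ k},
        θ < ((∫ y, φ y ∂m) - ∫ y, φ y ∂μ) / (∫ y, φ y ∂m) →
        ((binaryKL (∫ y, φ y ∂μ) ((1 - θ) * ∫ y, φ y ∂m) / (-Real.log θ) : ℝ) : EReal) ≤
          ((measureEntropy m (fun y => a • y) : EReal) - (h : EReal)) /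
            ((-Real.log lam : ℝ) : EReal)) := by
  have hlam0 : 0 ≤ lam := hlam ▸ averagingNorm_nonneg _ _
  rcases hlam0.eq_or_lt with h0 | h0
  -- For `λ = 0` also `θ = 0`; by `Real.log 0 = 0` and division by zero, both sides are `0`.
  · subst h0
    constructor
    all_goals
      rintro - - θ ⟨k, hk, rfl⟩ -
      simp [zero_pow (show k ≠ 0 by omega)]
  have hφm : Measurable φ := hφX.mono (stateAlgebra_le Γ K) le_rfl
  have hsub : ∀ ν : Measure (RightCosetSpace Γ), IsProbabilityMeasure ν →
      ∫ y, (1 - φ y) ∂ν = 1 - ∫ y, φ y ∂ν := fun ν _ => by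
    rw [integral_sub (integrable_const _) (Integrable.of_bound hφm.aestronglyMeasurable 1
      (Eventually.of_forall fun y => by
        rw [Real.norm_of_nonneg (hφ01 y).1]
        exact (hφ01 y).2))]
    simp
  constructor
  · rintro h1 hlt θ ⟨k, hk, rfl⟩ hθ
    exact coe_div_neg_log_le hk h0 hgap fun h' h0' hm =>
      binaryKL_le_of_lt hK hlam h0 hgap hM hhom hinv hlim hFc hFmass hFbowen hφ01 hφX hφ h1 hlt hk
        hθ h0' hm
  · rintro h1 hlt θ ⟨k, hk, rfl⟩ hθ
    refine coe_div_neg_log_le hk h0 hgap fun h' h0' hm => ?_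
    have hφ' : Continuous (fun y => 1 - φ y) ∨
        ∃ A : Set (StateSpace Γ K), (IsClosed A ∨ IsOpen A) ∧
          (fun y => 1 - φ y) = (stateMap Γ K ⁻¹' A).indicator (fun _ => (1 : ℝ)) := by
      refine hφ.imp continuous_const.sub ?_
      rintro ⟨A, hA, rfl⟩
      refine ⟨Aᶜ, hA.symm.imp (fun h => h.isClosed_compl) (fun h => h.isOpen_compl), funext fun y => ?_⟩
      by_cases hy : stateMap Γ K y ∈ A <;> simp [hy]
    have key := binaryKL_le_of_lt hK hlam h0 hgap hM hhom hinv hlim hFc hFmass hFbowen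
      (φ := fun y => 1 - φ y)
      (fun y => ⟨sub_nonneg.2 (hφ01 y).2, sub_le_self _ (hφ01 y).1⟩) (hφX.const_sub 1) hφ'
      (by rw [hsub μ inferInstance]; linarith)
      (by rw [hsub μ inferInstance, hsub m inferInstance]; linarith) hk
      (by
        rw [hsub μ inferInstance, hsub m inferInstance]
        convert hθ using 1
        congr 1 <;> ring) h0' hm
    rw [hsub μ inferInstance, hsub m inferInstance] at key
    -- The divergence is unchanged when both arguments are complemented, and `θ + (1-θ)(1-q) = 1 -
    -- (1-θ)q`.
    rw [← binaryKL_one_sub]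
    convert key using 2
    ring
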